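/- A polygon with $n$ vertices is a simple closed polygonal curve $\partial P$ in the plane with vertices $v_1,\dots,v_n$ in counterclockwise order (vertices with interior angle $\pi$ are allowed), together with the region it bounds; $e_i$ denotes the open edge from $v_i$ to $v_{i+1}$. A gluing of $P$ cuts $\partial P$ by finitely many points into open intervals and glues each interval, by a length-preserving bijection, to another one; corresponding endpoints are identified, and gluing is transitive. It is an Aleksandrov gluing if (1) at every point the total face angle glued together is at most $2\pi$ (the face angle is the interior angle at a vertex and $\pi$ at other boundary points), and (2) the surface obtained from $P$ is homeomorphic to the sphere. The combinatorial gluing tree of a gluing has as nodes the points of the glued boundary at which the number of boundary points glued together is different from two, or to which a vertex of $P$ is glued; its arcs are the intervals of the glued boundary that join two nodes without meeting another node; each node is labeled with the set of all vertices $v_i$ and edges $e_i$ of $P$ that are glued together there. Two gluings of $P$ are combinatorially distinct if their gluing trees are not isomorphic as labeled trees. Theorem. There is a constant $c>0$ such that for every even $n\ge 4$ there is a polygon with $n$ vertices that has at least $2^{cn}$ combinatorially distinct Aleksandrov gluings. Moreover, when $n=2m+2$ with $m\ge 4$ even, this polygon can be chosen as a centrally symmetric equilateral star with two extra midpoint vertices: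 a centrally symmetric $2m$-gon with all edges of equal length whose interior angles are alternately a convex angle $\alpha\in(0,\pi)$ and a reflex angle $\beta>\pi$ with $m\alpha+\beta<2\pi$, to which the midpoints of two opposite edges are added as vertices. -/

import Mathlib

namespace Polygon

variable {n : ℕ}

/-- The closed boundary curve of the polygon does not intersect itself: its parametrization by the
half-open edges `[v i, v (i+1))` is injective. (This forces `3 ≤ n`. Vertices at which the two
edges are collinear, i.e. with interior angle `π`, are allowed.) -/
def IsSimple (P : Polygon ℂ n) : Prop :=
  ∀ i j : Fin n, ∀ s ∈ Set.Ico (0 : ℝ) 1, ∀ t ∈ Set.Ico (0 : ℝ) 1,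
    P.edgePath ℝ i s = P.edgePath ℝ j t → i = j ∧ s = t

/-- The vertices are labeled counterclockwise: the (doubled) signed area is positive. -/
def IsCounterclockwise (P : Polygon ℂ n) : Prop :=
  0 < ∑ i : Fin n, ((starRingEnd ℂ) (P i) * P (finRotate n i)).im

/-- The plane region of the polygon: the boundary together with all points that the boundary
separates from infinity. -/
def region (P : Polygon ℂ n) : Set ℂ :=
  {p | p ∈ P.boundary ℝ ∨
    Bornology.IsBounded (connectedComponentIn (P.boundary ℝ)ᶜ p)}

/-- The interior angle, in `[0, 2π)`, at the vertex `v i` of a counterclockwise polygon: the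
counterclockwise angle from the ray towards `v (i+1)` to the ray towards `v (i-1)`. -/
noncomputable def angle (P : Polygon ℂ n) (i : Fin n) : ℝ :=
  toIcoMod Real.two_pi_pos 0
    (Complex.arg ((P ((finRotate n).symm i) - P i) / (P (finRotate n i) - P i)))

open Classical in
/-- The face angle at a boundary point: the interior angle at a vertex, and `π` at a point in the
interior of an edge. -/
noncomputable def faceAngle (P : Polygon ℂ n) (p : ℂ) : ℝ :=
  if h : ∃ i, P i = p then P.angle h.choose else Real.pi

/-- A gluing of the boundary of `P` to itself. The boundary is cut by finitely many points into
open intervals, each of which is glued, preserving length, to another one. Cutting further at the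
vertices and at the points glued to them does not change what is glued to what, so the intervals
are taken to be straight. The interval number `j` has the end points `start j` and `finish j`
(in either order along the boundary), and it is glued to the interval number `partner j` so that
`start` goes to `start` and `finish` to `finish`. -/
structure Gluing (P : Polygon ℂ n) where
  /-- the number of intervals -/
  size : ℕ
  /-- first end point of each interval -/
  start : Fin size → ℂ
  /-- second end point of each interval -/
  finish : Fin size → ℂ
  /-- the interval to which an interval is glued -/
  partner : Fin size → Fin size
  start_ne_finish : ∀ j, start j ≠ finish j
  disjoint : ∀ i j, i ≠ j →
    Disjoint (openSegment ℝ (start i) (finish i)) (openSegment ℝ (start j) (finish j))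
  cover : ⋃ j, segment ℝ (start j) (finish j) = P.boundary ℝ
  partner_ne : ∀ j, partner j ≠ j
  partner_partner : ∀ j, partner (partner j) = j
  dist_partner : ∀ j,
    dist (start (partner j)) (finish (partner j)) = dist (start j) (finish j)

namespace Gluing

variable {P : Polygon ℂ n}

/-- The equivalence relation "glued together", generated by the gluing maps of the closed
intervals. A point off the boundary is related only to itself. -/
def setoid (G : Gluing P) : Setoid ℂ :=
  Relation.EqvGen.setoid fun p q => ∃ j, ∃ t ∈ Set.Icc (0 : ℝ) 1,
    p = AffineMap.lineMap (G.start j) (G.finish j) t ∧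
    q = AffineMap.lineMap (G.start (G.partner j)) (G.finish (G.partner j)) t

/-- The set of boundary points that are glued to `p` (including `p`). -/
def fiber (G : Gluing P) (p : ℂ) : Set ℂ :=
  {q | q ∈ P.boundary ℝ ∧ G.setoid p q}

/-- The surface obtained from the polygon by gluing its boundary, with the quotient topology. -/
abbrev Surface (G : Gluing P) : Type :=
  Quotient (Setoid.comap (Subtype.val : P.region → ℂ) G.setoid)

/-- An Aleksandrov gluing: the total face angle glued together at any point is at most `2π`, and
the resulting surface is homeomorphic to the sphere. -/
structure IsAleksandrov (G : Gluing P) : Prop where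
  angle_le : ∀ p ∈ P.boundary ℝ, ∀ s : Finset ℂ, (s : Set ℂ) ⊆ G.fiber p →
    ∑ q ∈ s, P.faceAngle q ≤ 2 * Real.pi
  sphere : Nonempty (G.Surface ≃ₜ Metric.sphere (0 : EuclideanSpace ℝ (Fin 3)) 1)

/-- The boundary points that become nodes of the gluing tree: those identified with more or less
than one other boundary point, and those to which a vertex is glued. -/
def IsNodePoint (G : Gluing P) (p : ℂ) : Prop :=
  p ∈ P.boundary ℝ ∧ ((G.fiber p).ncard ≠ 2 ∨ ∃ i, P i ∈ G.fiber p)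

/-- The nodes of the combinatorial gluing tree. -/
def Node (G : Gluing P) : Type :=
  {A : Set ℂ // ∃ p, G.IsNodePoint p ∧ A = G.fiber p}

/-- The combinatorial gluing tree: two nodes are joined if some boundary interval runs from one to
the other without meeting another node. (All vertices are node points, so such an interval is
straight.) -/
def tree (G : Gluing P) : SimpleGraph G.Node where
  Adj A B := A ≠ B ∧ ∃ p ∈ A.1, ∃ q ∈ B.1, segment ℝ p q ⊆ P.boundary ℝ ∧
    ∀ z ∈ openSegment ℝ p q, ¬ G.IsNodePoint z
  symm := by
    constructor
    rintro A B ⟨hAB, p, hp, q, hq, hpq, hz⟩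
    exact ⟨hAB.symm, q, hq, p, hp, by rwa [segment_symm], by rwa [openSegment_symm]⟩
  loopless := ⟨fun A h => h.1 rfl⟩

/-- The label of a node: the set of all vertices (`Sum.inl i`) and of all open edges (`Sum.inr i`,
the edge after the vertex `i`) that are glued together there. -/
def label (G : Gluing P) (A : G.Node) : Set (Fin n ⊕ Fin n) :=
  {x | Sum.elim (fun i => P i ∈ A.1)
    (fun i => (openSegment ℝ (P i) (P (finRotate n i)) ∩ A.1).Nonempty) x}

/-- Two gluings of `P` are combinatorially equivalent if their combinatorial gluing trees are
isomorphic as labeled trees. -/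
def CombEquiv (G H : Gluing P) : Prop :=
  ∃ φ : G.tree ≃g H.tree, ∀ A, H.label (φ A) = G.label A

end Gluing

/-- `P` has at least `N` combinatorially distinct Aleksandrov gluings. -/
def HasDistinctAleksandrovGluings (P : Polygon ℂ n) (N : ℝ) : Prop :=
  ∃ F : Finset (Gluing P), N ≤ (F.card : ℝ) ∧ (∀ G ∈ F, G.IsAleksandrov) ∧
    ∀ G ∈ F, ∀ H ∈ F, G ≠ H → ¬ G.CombEquiv H

/-- The vertex number `k`, counted modulo `n`. -/
def vertexAt [NeZero n] (P : Polygon ℂ n) (k : ℕ) : ℂ :=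
  P (Fin.ofNat n k)

/-- `P` is a centrally symmetric equilateral star with `m` tips, to which the midpoints of two
opposite edges have been added as vertices: these are the vertices number `0` and `m + 1`, the
vertices number `1, …, m` and `m + 2, …, 2 m + 1` are those of the star, with interior angles that
are alternately equal to a convex `α` and a reflex `β`, where `m α + β < 2π`. -/
def IsStarWithMidpoints {m : ℕ} (P : Polygon ℂ (2 * m + 2)) : Prop :=
  (∃ o : ℂ, ∀ k : ℕ, P.vertexAt (k + (m + 1)) = Equiv.pointReflection o (P.vertexAt k)) ∧
  P.vertexAt 0 = midpoint ℝ (P.vertexAt (2 * m + 1)) (P.vertexAt 1) ∧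
  P.vertexAt (m + 1) = midpoint ℝ (P.vertexAt m) (P.vertexAt (m + 2)) ∧
  (∃ l : ℝ, dist (P.vertexAt (2 * m + 1)) (P.vertexAt 1) = l ∧
    dist (P.vertexAt m) (P.vertexAt (m + 2)) = l ∧
    ∀ k : ℕ, 1 ≤ k → k < m →
      dist (P.vertexAt k) (P.vertexAt (k + 1)) = l ∧
      dist (P.vertexAt (m + 1 + k)) (P.vertexAt (m + 1 + (k + 1))) = l) ∧
  ∃ α β : ℝ, 0 < α ∧ α < Real.pi ∧ Real.pi < β ∧ m * α + β < 2 * Real.pi ∧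
    ∀ k : ℕ, 1 ≤ k → k ≤ m →
      P.angle (Fin.ofNat (2 * m + 2) k) = (if Odd k then α else β) ∧
      P.angle (Fin.ofNat (2 * m + 2) (m + 1 + k)) = (if Odd k then α else β)

end Polygon

/-! Number the boundary from one added midpoint and glue the vertex number `k` to the vertex number
`2 * m + 2 - k`. Apart from the two midpoints, which become leaves, this pairs a tip with a reflex
vertex. The half edges at each midpoint are glued to each other and all other edges have equal
length, so the gluing exists whether or not the star is symmetric about the line through the
midpoints. In a block of four consecutive edges, together with its mirror block, there is a second
option: zip up one reflex vertex on each side, at positions that differ by one. Each side then loses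
two edges, and the remaining edges still match. A class of glued vertices that contains no midpoint
has at most one reflex vertex and at most `m` tips, so `m α + β < 2π` bounds its angle. The options
in the `m / 4` blocks are independent, which gives `2 ^ (m / 4)` gluings. They are distinguished by
their labels: the vertex `4 * q + 2` is a leaf if block `q` is zipped and is glued to its mirror
vertex otherwise (`eq_of_starClass_partner_eq`), while an isomorphism of labeled trees preserves
which vertices are glued together (`Gluing.CombEquiv.setoid`).

That the glued surface is a sphere is proved for every folding of a star-shaped polygon to a tree
(`IsFolding`), by an explicit map. The polygon is the cone over its boundary curve
(`WindsOnce.region_eq`). The function `level` interpolates linearly on each ray from the height in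
the tree, at the boundary, to a common larger value `top` at the center. In the polygon a level set
is a closed curve interrupted where the boundary rises above the level; the two ends of each gap are
glued together, so the level set closes up to a circle in the surface. The integral `phase` of the
positive part of level minus height is constant on the gaps and strictly increasing elsewhere, so
its normalization is a longitude on this circle. Level and longitude give a map from the compact
cone onto the sphere whose fibers are exactly the gluing classes (`nonempty_surface_homeomorph`).

For fewer than ten vertices two gluings suffice, and a regular polygon folded along two different
diagonals provides them. -/

/-! ### Piecewise linear paths -/

/-- The piecewise linear path that passes through `f k` at time `k`, for `0 ≤ k ≤ n`. -/
noncomputable def piecewiseLinear {E : Type*} [AddCommGroup E] [Module ℝ E] (n : ℕ) (f : ℕ → E)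
    (s : ℝ) : E :=
  f 0 + ∑ k ∈ Finset.range n, (max 0 (min 1 (s - k))) • (f (k + 1) - f k)

section PiecewiseLinear

variable {E : Type*} [AddCommGroup E] [Module ℝ E]

lemma piecewiseLinear_of_le (n : ℕ) (f : ℕ → E) {s : ℝ} (hs : (n : ℝ) ≤ s) :
    piecewiseLinear n f s = f n := by
  induction n with
  | zero => simp [piecewiseLinear]
  | succ n ih =>
    push_cast at hs
    have h := ih (by linarith)
    unfold piecewiseLinear at h ⊢
    rw [Finset.sum_range_succ, ← add_assoc, h, min_eq_left (by linarith), max_eq_right zero_le_one]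
    simp

lemma piecewiseLinear_apply {n : ℕ} (f : ℕ → E) {k : ℕ} (hk : k < n) {t : ℝ}
    (ht : t ∈ Set.Icc (0 : ℝ) 1) :
    piecewiseLinear n f (k + t) = f k + t • (f (k + 1) - f k) := by
  induction n with
  | zero => omega
  | succ n ih =>
    have e : piecewiseLinear (n + 1) f (k + t) = piecewiseLinear n f (k + t) +
        (max 0 (min 1 ((k : ℝ) + t - n))) • (f (n + 1) - f n) := by
      simp only [piecewiseLinear, Finset.sum_range_succ, add_assoc]
    rw [e]
    rcases Nat.lt_succ_iff_lt_or_eq.1 hk with h | rfl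
    · have h' : (k : ℝ) + 1 ≤ n := by exact_mod_cast h
      have : min 1 ((k : ℝ) + t - n) ≤ 0 := (min_le_right _ _).trans (by linarith [ht.2])
      rw [ih h, max_eq_left this]
      simp
    · rw [piecewiseLinear_of_le _ _ (by linarith [ht.1]), add_sub_cancel_left,
        min_eq_right ht.2, max_eq_right ht.1]

lemma piecewiseLinear_natCast {n : ℕ} (f : ℕ → E) {k : ℕ} (hk : k ≤ n) :
    piecewiseLinear n f k = f k := by
  rcases hk.lt_or_eq with h | rfl
  · simpa using piecewiseLinear_apply f h (t := 0) (by simp)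
  · exact piecewiseLinear_of_le _ _ le_rfl

lemma continuous_piecewiseLinear {E : Type*} [NormedAddCommGroup E] [NormedSpace ℝ E] (n : ℕ)
    (f : ℕ → E) : Continuous (piecewiseLinear n f) := by
  unfold piecewiseLinear
  fun_prop

end PiecewiseLinear

lemma exists_nat_add_of_mem_Ico {n : ℕ} {s : ℝ} (hs : s ∈ Set.Ico (0 : ℝ) n) :
    ∃ k < n, ∃ t ∈ Set.Ico (0 : ℝ) 1, s = k + t := by
  refine ⟨⌊s⌋₊, (Nat.floor_lt hs.1).2 hs.2, s - ⌊s⌋₊, ⟨?_, ?_⟩, by ring⟩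
  · linarith [Nat.floor_le hs.1]
  · linarith [Nat.lt_floor_add_one s]

lemma exists_nat_add_of_mem_Icc {n : ℕ} (hn : 0 < n) {s : ℝ} (hs : s ∈ Set.Icc (0 : ℝ) n) :
    ∃ k < n, ∃ t ∈ Set.Icc (0 : ℝ) 1, s = k + t := by
  rcases hs.2.lt_or_eq with h | h
  · obtain ⟨k, hk, t, ht, e⟩ := exists_nat_add_of_mem_Ico ⟨hs.1, h⟩
    exact ⟨k, hk, t, ⟨ht.1, ht.2.le⟩, e⟩
  · exact ⟨n - 1, by omega, 1, by simp, by rw [h, Nat.cast_sub hn]; simp⟩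

/-! ### Polygons that are star-shaped about the origin -/

/-- The closed polygonal curve with vertices `V 0, V 1, …, V n = V 0` goes once counterclockwise
around the origin: `V k` has the polar coordinates `ρ k` and `θ k`. -/
structure WindsOnce (n : ℕ) (V : ℕ → ℂ) (ρ θ : ℕ → ℝ) : Prop where
  pos : ∀ k, 0 < ρ k
  eq : ∀ k, V k = ρ k * Complex.exp (θ k * Complex.I)
  lt : ∀ k < n, θ k < θ (k + 1)
  sub_lt : ∀ k < n, θ (k + 1) - θ k < Real.pi
  closed : V n = V 0
  winding : θ n = θ 0 + 2 * Real.pi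

/-- A combination of two directions with nonnegative coefficients, the first one positive, stays in
the sector between them: an argument of at least `δ` would make the sine of its difference from `δ`
nonnegative, whereas that sine has the sign of `-A * sin δ`. -/
lemma exists_polar_of_sector {A B δ : ℝ} (hA : 0 < A) (hB : 0 ≤ B) (hδ : 0 < δ)
    (hδ' : δ < Real.pi) : ∃ R : ℝ, 0 < R ∧ ∃ ψ ∈ Set.Ico 0 δ,
      (A + B * Complex.exp (δ * Complex.I) : ℂ) = R * Complex.exp (ψ * Complex.I) := by
  set z : ℂ := A + B * Complex.exp (δ * Complex.I) with hz
  have hs : 0 < Real.sin δ := Real.sin_pos_of_pos_of_lt_pi hδ hδ'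
  have him : z.im = B * Real.sin δ := by
    simp [hz, Complex.exp_ofReal_mul_I_im]
  have hre : z.re = A + B * Real.cos δ := by
    simp [hz, Complex.exp_ofReal_mul_I_re]
  have h0 : z ≠ 0 := by
    intro h
    rw [h] at him hre
    simp only [Complex.zero_im, Complex.zero_re] at him hre
    rcases mul_eq_zero.1 him.symm with h1 | h1
    · rw [h1] at hre; linarith
    · linarith
  have hR : 0 < ‖z‖ := norm_pos_iff.2 h0
  have e : z = ‖z‖ * Complex.exp (z.arg * Complex.I) := (Complex.norm_mul_exp_arg_mul_I z).symm
  refine ⟨‖z‖, hR, z.arg, ⟨Complex.arg_nonneg_iff.2 (by rw [him]; positivity), ?_⟩, e⟩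
  by_contra! h
  have h1 : 0 ≤ Real.sin (z.arg - δ) :=
    Real.sin_nonneg_of_nonneg_of_le_pi (by linarith) (by linarith [Complex.arg_le_pi z])
  have e1 : ‖z‖ * Real.cos z.arg = z.re := by
    have := congrArg Complex.re e
    rw [this, Complex.re_ofReal_mul, Complex.exp_ofReal_mul_I_re]
  have e2 : ‖z‖ * Real.sin z.arg = z.im := by
    have := congrArg Complex.im e
    rw [this, Complex.im_ofReal_mul, Complex.exp_ofReal_mul_I_im]
  have h2 : ‖z‖ * Real.sin (z.arg - δ) = -(A * Real.sin δ) := by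
    rw [Real.sin_sub]
    linear_combination (-Real.sin δ) * e1 + Real.cos δ * e2 + Real.cos δ * him - Real.sin δ * hre
  nlinarith [mul_nonneg hR.le h1, mul_pos hA hs]

namespace WindsOnce

variable {n : ℕ} {V : ℕ → ℂ} {ρ θ : ℕ → ℝ}

lemma le (W : WindsOnce n V ρ θ) {j k : ℕ} (hjk : j ≤ k) (hk : k ≤ n) : θ j ≤ θ k := by
  induction k, hjk using Nat.le_induction with
  | base => exact le_rfl
  | succ k _ ih => exact (ih (by omega)).trans (W.lt k (by omega)).le

lemma n_pos (W : WindsOnce n V ρ θ) : 0 < n := by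
  rcases Nat.eq_zero_or_pos n with rfl | h
  · have := W.winding
    linarith [Real.pi_pos]
  · exact h

lemma succ_eq (W : WindsOnce n V ρ θ) (k : ℕ) : V (k + 1) =
    Complex.exp (θ k * Complex.I) * (ρ (k + 1) *
      Complex.exp ((θ (k + 1) - θ k : ℝ) * Complex.I)) := by
  rw [W.eq, mul_left_comm, ← Complex.exp_add]
  congr 3
  push_cast
  ring

lemma add_smul_eq (W : WindsOnce n V ρ θ) (k : ℕ) (t : ℝ) : V k + t • (V (k + 1) - V k) =
    Complex.exp (θ k * Complex.I) * (((1 - t) * ρ k : ℝ) + (t * ρ (k + 1) : ℝ) *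
      Complex.exp ((θ (k + 1) - θ k : ℝ) * Complex.I)) := by
  rw [W.succ_eq, W.eq k, Complex.real_smul]
  push_cast
  ring

lemma exists_polar (W : WindsOnce n V ρ θ) {k : ℕ} (hk : k < n) {t : ℝ}
    (ht : t ∈ Set.Ico (0 : ℝ) 1) : ∃ R : ℝ, 0 < R ∧ ∃ ψ ∈ Set.Ico (θ k) (θ (k + 1)),
      piecewiseLinear n V (k + t) = R * Complex.exp (ψ * Complex.I) := by
  have h1 : 0 < 1 - t := by linarith [ht.2]
  obtain ⟨R, hR, ψ, hψ, e⟩ := exists_polar_of_sector (mul_pos h1 (W.pos k))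
    (mul_nonneg ht.1 (W.pos (k + 1)).le) (sub_pos.2 (W.lt k hk)) (W.sub_lt k hk)
  refine ⟨R, hR, θ k + ψ, ⟨by linarith [hψ.1], by linarith [hψ.2]⟩, ?_⟩
  rw [piecewiseLinear_apply V hk ⟨ht.1, ht.2.le⟩, W.add_smul_eq, e, mul_left_comm,
    ← Complex.exp_add]
  congr 2
  push_cast
  ring

lemma exp_eq {a b c : ℝ} (ha : a ∈ Set.Ico c (c + 2 * Real.pi))
    (hb : b ∈ Set.Ico c (c + 2 * Real.pi)) {R R' : ℝ} (hR : 0 < R) (hR' : 0 < R')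
    (h : (R * Complex.exp (a * Complex.I) : ℂ) = R' * Complex.exp (b * Complex.I)) :
    R = R' ∧ a = b := by
  have h1 : R = R' := by
    have := congrArg norm h
    simpa [Complex.norm_exp_ofReal_mul_I, abs_of_pos hR, abs_of_pos hR'] using this
  subst h1
  have h2 := mul_left_cancel₀ (by exact_mod_cast hR.ne') h
  obtain ⟨z, hz⟩ := Complex.exp_eq_exp_iff_exists_int.1 h2
  have h3 : a = b + z * (2 * Real.pi) := by
    have := congrArg Complex.im hz
    simpa using this
  have hp := Real.two_pi_pos
  have h4 : (z : ℝ) < 1 := by nlinarith [ha.1, ha.2, hb.1, hb.2]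
  have h5 : (-1 : ℝ) < z := by nlinarith [ha.1, ha.2, hb.1, hb.2]
  have h6 : z = 0 := by
    have h4' : z < 1 := by exact_mod_cast h4
    have h5' : -1 < z := by exact_mod_cast h5
    omega
  simp [h3, h6]

/-- The half-open angular sectors of the edges tile one full turn, so the argument determines the
edge. The end points of that edge are linearly independent because the sine of the angle between
them is positive; comparing coordinates recovers `r * (1 - t)` and `r * t`. -/
lemma eq_of_smul_eq (W : WindsOnce n V ρ θ) {k k' : ℕ} (hk : k < n) (hk' : k' < n) {t t' : ℝ}
    (ht : t ∈ Set.Ico (0 : ℝ) 1) (ht' : t' ∈ Set.Ico (0 : ℝ) 1) {r r' : ℝ} (hr : 0 < r)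
    (hr' : 0 < r')
    (h : r • piecewiseLinear n V (k + t) = r' • piecewiseLinear n V (k' + t')) :
    r = r' ∧ k = k' ∧ t = t' := by
  obtain ⟨R, hR, ψ, hψ, e⟩ := W.exists_polar hk ht
  obtain ⟨R', hR', ψ', hψ', e'⟩ := W.exists_polar hk' ht'
  have hkk : k = k' := by
    have hI : ∀ j < n, ∀ x ∈ Set.Ico (θ j) (θ (j + 1)),
        x ∈ Set.Ico (θ 0) (θ 0 + 2 * Real.pi) := fun j hj x hx =>
      ⟨(W.le (Nat.zero_le j) hj.le).trans hx.1,
        hx.2.trans_le (W.winding ▸ W.le (show j + 1 ≤ n by omega) le_rfl)⟩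
    rw [e, e', Complex.real_smul, Complex.real_smul, ← mul_assoc, ← mul_assoc,
      ← Complex.ofReal_mul, ← Complex.ofReal_mul] at h
    obtain ⟨-, h2⟩ := exp_eq (hI k hk ψ hψ) (hI k' hk' ψ' hψ') (mul_pos hr hR) (mul_pos hr' hR') h
    subst h2
    by_contra hne
    rcases Nat.lt_or_gt_of_ne hne with hlt | hlt
    · linarith [W.le (show k + 1 ≤ k' by omega) hk'.le, hψ.2, hψ'.1]
    · linarith [W.le (show k' + 1 ≤ k by omega) hk.le, hψ'.2, hψ.1]
  subst hkk
  rw [piecewiseLinear_apply V hk ⟨ht.1, ht.2.le⟩, piecewiseLinear_apply V hk ⟨ht'.1, ht'.2.le⟩,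
    W.add_smul_eq, W.add_smul_eq, Complex.real_smul, Complex.real_smul, mul_left_comm,
    mul_left_comm (r' : ℂ)] at h
  have h := mul_left_cancel₀ (Complex.exp_ne_zero _) h
  have hs := Real.sin_pos_of_pos_of_lt_pi (sub_pos.2 (W.lt k hk)) (W.sub_lt k hk)
  have him := congrArg Complex.im h
  have hre := congrArg Complex.re h
  simp only [Complex.mul_im, Complex.mul_re, Complex.add_im, Complex.add_re, Complex.ofReal_re,
    Complex.ofReal_im, Complex.exp_ofReal_mul_I_im, Complex.exp_ofReal_mul_I_re] at him hre
  set S := Real.sin (θ (k + 1) - θ k)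
  set C := Real.cos (θ (k + 1) - θ k)
  have hp1 := W.pos k
  have hp2 := W.pos (k + 1)
  have e1 : r * t = r' * t' := by
    have : (r * t) * (ρ (k + 1) * S) = (r' * t') * (ρ (k + 1) * S) := by linear_combination him
    exact mul_right_cancel₀ (by positivity) this
  have e2 : r * (1 - t) = r' * (1 - t') := by
    have : (r * (1 - t)) * ρ k = (r' * (1 - t')) * ρ k := by
      linear_combination hre - (ρ (k + 1) * C) * e1
    exact mul_right_cancel₀ hp1.ne' this
  have e3 : r = r' := by linarith
  subst e3
  exact ⟨rfl, rfl, mul_left_cancel₀ hr.ne' e1⟩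

lemma exists_smul_eq (W : WindsOnce n V ρ θ) {z : ℂ} (hz : z ≠ 0) :
    ∃ r > 0, ∃ k < n, ∃ t ∈ Set.Ico (0 : ℝ) 1, z = (r : ℝ) • piecewiseLinear n V (k + t) := by
  set ψ := toIcoMod Real.two_pi_pos (θ 0) z.arg with hψ
  have hmem : ψ ∈ Set.Ico (θ 0) (θ 0 + 2 * Real.pi) := toIcoMod_mem_Ico _ _ _
  have hzz : z = ‖z‖ * Complex.exp (ψ * Complex.I) := by
    have hper : Complex.exp (ψ * Complex.I) = Complex.exp (z.arg * Complex.I) := by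
      rw [Complex.exp_eq_exp_iff_exists_int]
      refine ⟨-toIcoDiv Real.two_pi_pos (θ 0) z.arg, ?_⟩
      rw [hψ, toIcoMod]
      push_cast
      simp only [zsmul_eq_mul]
      ring
    rw [hper, Complex.norm_mul_exp_arg_mul_I]
  -- The edge ends at the first vertex whose angle exceeds `ψ`.
  obtain ⟨k, hk, hk1, hk2⟩ : ∃ k < n, θ k ≤ ψ ∧ ψ < θ (k + 1) := by
    have hex : ∃ j, ψ < θ j ∧ j ≤ n := ⟨n, W.winding ▸ hmem.2, le_rfl⟩
    classical
    have h1 := Nat.find_spec hex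
    have h0 : Nat.find hex ≠ 0 := by
      intro h
      rw [h] at h1
      linarith [hmem.1, h1.1]
    obtain ⟨k, hk⟩ := Nat.exists_eq_succ_of_ne_zero h0
    rw [hk] at h1
    refine ⟨k, by omega, ?_, h1.1⟩
    by_contra! h
    exact Nat.find_min hex (m := k) (by omega) ⟨h, by omega⟩
  have hS := Real.sin_pos_of_pos_of_lt_pi (sub_pos.2 (W.lt k hk)) (W.sub_lt k hk)
  have hp1 := W.pos k
  have hp2 := W.pos (k + 1)
  have hz0 : 0 < ‖z‖ := norm_pos_iff.2 hz
  have hlt := W.sub_lt k hk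
  set S := Real.sin (θ (k + 1) - θ k) with hSdef
  -- `A` and `B` are the coordinates of `z` in the basis `V k`, `V (k + 1)`, by Cramer's rule.
  set A := ‖z‖ * Real.sin (θ (k + 1) - ψ) / (S * ρ k) with hA
  set B := ‖z‖ * Real.sin (ψ - θ k) / (S * ρ (k + 1)) with hB
  have hA0 : 0 < A := by
    have := Real.sin_pos_of_pos_of_lt_pi (show 0 < θ (k + 1) - ψ by linarith) (by linarith)
    positivity
  have hB0 : 0 ≤ B := by
    have := Real.sin_nonneg_of_nonneg_of_le_pi (show 0 ≤ ψ - θ k by linarith) (by linarith)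
    positivity
  have ht : B / (A + B) ∈ Set.Ico (0 : ℝ) 1 :=
    ⟨by positivity, (div_lt_one (by positivity)).2 (by linarith)⟩
  refine ⟨A + B, by positivity, k, hk, B / (A + B), ht, ?_⟩
  rw [piecewiseLinear_apply V hk ⟨ht.1, ht.2.le⟩]
  have e : (A + B : ℝ) • (V k + (B / (A + B)) • (V (k + 1) - V k)) = A • V k + B • V (k + 1) := by
    rw [smul_add, smul_smul, mul_div_cancel₀ _ (by positivity : A + B ≠ 0)]
    module
  rw [e, W.eq, W.eq, hzz]
  have eA : A * ρ k * S = ‖z‖ * Real.sin (θ (k + 1) - ψ) := by rw [hA]; field_simp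
  have eB : B * ρ (k + 1) * S = ‖z‖ * Real.sin (ψ - θ k) := by rw [hB]; field_simp
  have e1 : Real.sin (θ (k + 1) - ψ) * Real.cos (θ k) + Real.sin (ψ - θ k) * Real.cos (θ (k + 1)) =
      S * Real.cos ψ := by
    rw [hSdef, Real.sin_sub, Real.sin_sub, Real.sin_sub]; ring
  have e2 : Real.sin (θ (k + 1) - ψ) * Real.sin (θ k) + Real.sin (ψ - θ k) * Real.sin (θ (k + 1)) =
      S * Real.sin ψ := by
    rw [hSdef, Real.sin_sub, Real.sin_sub, Real.sin_sub]; ring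
  apply Complex.ext
  · simp only [Complex.add_re, Complex.real_smul, Complex.re_ofReal_mul,
      Complex.exp_ofReal_mul_I_re]
    apply mul_right_cancel₀ hS.ne'
    linear_combination (-‖z‖) * e1 - Real.cos (θ k) * eA - Real.cos (θ (k + 1)) * eB
  · simp only [Complex.add_im, Complex.real_smul, Complex.im_ofReal_mul,
      Complex.exp_ofReal_mul_I_im]
    apply mul_right_cancel₀ hS.ne'
    linear_combination (-‖z‖) * e2 - Real.sin (θ k) * eA - Real.sin (θ (k + 1)) * eB

end WindsOnce

namespace Polygon

/-- The polygon with the vertices `V 0, …, V (n - 1)`. -/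
def ofSeq (n : ℕ) (V : ℕ → ℂ) : Polygon ℂ n := ⟨fun i => V i⟩

lemma ofSeq_apply {n : ℕ} (V : ℕ → ℂ) (i : Fin n) : ofSeq n V i = V i := rfl

lemma ofSeq_finRotate {n : ℕ} {V : ℕ → ℂ} (hV : V n = V 0) (i : Fin n) :
    ofSeq n V (finRotate n i) = V (i + 1) := by
  rw [ofSeq_apply]
  rcases n with _ | n
  · exact i.elim0
  · rw [coe_finRotate]
    split_ifs with h
    · rw [h, Fin.val_last, hV]
    · rfl

lemma ofSeq_finRotate_symm {n : ℕ} {V : ℕ → ℂ} (hV : V n = V 0) (i : Fin n) :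
    ofSeq n V ((finRotate n).symm i) = V (if (i : ℕ) = 0 then n - 1 else i - 1) := by
  obtain ⟨j, rfl⟩ := (finRotate n).surjective i
  rw [Equiv.symm_apply_apply, ofSeq_apply]
  rcases n with _ | n
  · exact j.elim0
  · rw [coe_finRotate]
    by_cases h : j = Fin.last n
    · simp [h]
    · simp [h]

lemma ofSeq_edgePath {n : ℕ} {V : ℕ → ℂ} (hV : V n = V 0) (i : Fin n) {t : ℝ}
    (ht : t ∈ Set.Icc (0 : ℝ) 1) :
    (ofSeq n V).edgePath ℝ i t = piecewiseLinear n V (i + t) := by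
  rw [edgePath, ofSeq_finRotate hV, ofSeq_apply, piecewiseLinear_apply V i.2 ht,
    AffineMap.lineMap_apply_module']
  abel

lemma ofSeq_boundary {n : ℕ} {V : ℕ → ℂ} (hn : 0 < n) (hV : V n = V 0) :
    (ofSeq n V).boundary ℝ = piecewiseLinear n V '' Set.Icc 0 n := by
  ext z
  simp only [boundary, Set.mem_iUnion, edgeSet_eq_image_edgePath, Set.mem_image]
  constructor
  · rintro ⟨i, t, ht, rfl⟩
    have : (i : ℝ) + 1 ≤ n := by exact_mod_cast i.2
    exact ⟨i + t, ⟨by have := ht.1; positivity, by linarith [ht.2]⟩,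
      (ofSeq_edgePath hV i ht).symm⟩
  · rintro ⟨s, hs, rfl⟩
    obtain ⟨k, hk, t, ht, rfl⟩ := exists_nat_add_of_mem_Icc hn hs
    exact ⟨⟨k, hk⟩, t, ht, ofSeq_edgePath hV ⟨k, hk⟩ ht⟩

end Polygon

open Polygon

namespace WindsOnce

variable {n : ℕ} {V : ℕ → ℂ} {ρ θ : ℕ → ℝ}

lemma isSimple (W : WindsOnce n V ρ θ) : (ofSeq n V).IsSimple := by
  intro i j s hs t ht h
  rw [ofSeq_edgePath W.closed i ⟨hs.1, hs.2.le⟩, ofSeq_edgePath W.closed j ⟨ht.1, ht.2.le⟩] at h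
  obtain ⟨-, h1, h2⟩ := W.eq_of_smul_eq i.2 j.2 hs ht one_pos one_pos (by rw [h])
  exact ⟨Fin.ext h1, h2⟩

lemma isCounterclockwise (W : WindsOnce n V ρ θ) : (ofSeq n V).IsCounterclockwise := by
  have : NeZero n := ⟨W.n_pos.ne'⟩
  refine Finset.sum_pos (fun i _ => ?_) Finset.univ_nonempty
  rw [ofSeq_finRotate W.closed, ofSeq_apply, W.succ_eq, W.eq i, map_mul, Complex.conj_ofReal,
    ← Complex.exp_conj, map_mul, Complex.conj_ofReal, Complex.conj_I, mul_assoc, ← mul_assoc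
    (Complex.exp _), ← Complex.exp_add]
  have hs := Real.sin_pos_of_pos_of_lt_pi (sub_pos.2 (W.lt i i.2)) (W.sub_lt i i.2)
  simp only [mul_neg, neg_add_cancel, Complex.exp_zero, one_mul, Complex.im_ofReal_mul,
    Complex.exp_ofReal_mul_I_im]
  exact mul_pos (W.pos _) (mul_pos (W.pos _) hs)

lemma eq_of_smul_eq_smul (W : WindsOnce n V ρ θ) {s s' : ℝ} (hs : s ∈ Set.Icc (0 : ℝ) n)
    (hs' : s' ∈ Set.Icc (0 : ℝ) n) {r r' : ℝ} (hr : 0 < r) (hr' : 0 < r')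
    (h : r • piecewiseLinear n V s = r' • piecewiseLinear n V s') :
    r = r' ∧ (s = s' ∨ s = 0 ∧ s' = n ∨ s = n ∧ s' = 0) := by
  have hn : (0 : ℝ) < n := by exact_mod_cast W.n_pos
  have key : ∀ x ∈ Set.Icc (0 : ℝ) n, ∃ y ∈ Set.Ico (0 : ℝ) n,
      piecewiseLinear n V x = piecewiseLinear n V y ∧ (x = y ∨ x = n ∧ y = 0) := by
    intro x hx
    rcases hx.2.lt_or_eq with h | h
    · exact ⟨x, ⟨hx.1, h⟩, rfl, .inl rfl⟩
    · refine ⟨0, ⟨le_rfl, hn⟩, ?_, .inr ⟨h, rfl⟩⟩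
      have h0 := piecewiseLinear_natCast V (Nat.zero_le n)
      rw [Nat.cast_zero] at h0
      rw [h, piecewiseLinear_natCast V le_rfl, h0, W.closed]
  obtain ⟨y, hy, e, hxy⟩ := key s hs
  obtain ⟨y', hy', e', hxy'⟩ := key s' hs'
  obtain ⟨k, hk, t, ht, rfl⟩ := exists_nat_add_of_mem_Ico hy
  obtain ⟨k', hk', t', ht', rfl⟩ := exists_nat_add_of_mem_Ico hy'
  rw [e, e'] at h
  obtain ⟨h1, rfl, rfl⟩ := W.eq_of_smul_eq hk hk' ht ht' hr hr' h
  refine ⟨h1, ?_⟩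
  rcases hxy with h2 | ⟨h2, h3⟩ <;> rcases hxy' with h2' | ⟨h2', h3'⟩
  · exact .inl (h2.trans h2'.symm)
  · exact .inr (.inl ⟨h2.trans h3', h2'⟩)
  · exact .inr (.inr ⟨h2, h2'.trans h3⟩)
  · exact .inl (h2.trans h2'.symm)

/-- At a zero of the curve the scalars `1` and `2` would give the same point, against the uniqueness
of the scalar. -/
lemma piecewiseLinear_ne_zero (W : WindsOnce n V ρ θ) {s : ℝ} (hs : s ∈ Set.Icc (0 : ℝ) n) :
    piecewiseLinear n V s ≠ 0 := by
  intro h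
  have := (W.eq_of_smul_eq_smul hs hs one_pos two_pos (by simp [h])).1
  norm_num at this

lemma exists_smul_piecewiseLinear (W : WindsOnce n V ρ θ) {z : ℂ} (hz : z ≠ 0) :
    ∃ r > 0, ∃ s ∈ Set.Icc (0 : ℝ) n, z = (r : ℝ) • piecewiseLinear n V s := by
  obtain ⟨r, hr, k, hk, t, ht, e⟩ := W.exists_smul_eq hz
  have : (k : ℝ) + 1 ≤ n := by exact_mod_cast hk
  exact ⟨r, hr, k + t, ⟨by have := ht.1; positivity, by linarith [ht.2]⟩, e⟩

/-- The region of a polygon that winds once around the origin is star-shaped. -/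
lemma region_eq (W : WindsOnce n V ρ θ) : (ofSeq n V).region =
    (fun x : ℝ × ℝ => x.1 • piecewiseLinear n V x.2) '' Set.Icc 0 1 ×ˢ Set.Icc 0 (n : ℝ) := by
  set γ := piecewiseLinear n V with hγ
  have hc : Continuous γ := continuous_piecewiseLinear n V
  have hB : (ofSeq n V).boundary ℝ = γ '' Set.Icc 0 n := ofSeq_boundary W.n_pos W.closed
  have hn : (0 : ℝ) ≤ n := Nat.cast_nonneg n
  -- `K` is the cone inside the curve and `E`, below, the cone outside it. Both are closed, they
  -- cover the plane, and they meet only in the curve; hence the complement of the curve is the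
  -- disjoint union of the open sets `Eᶜ` (inside) and `Kᶜ` (outside).
  set K := (fun x : ℝ × ℝ => x.1 • γ x.2) '' Set.Icc 0 1 ×ˢ Set.Icc 0 (n : ℝ) with hK
  have hKc : IsCompact K := (isCompact_Icc.prod isCompact_Icc).image (by fun_prop)
  obtain ⟨d, hd, hdγ⟩ : ∃ d > 0, ∀ s ∈ Set.Icc (0 : ℝ) n, d ≤ ‖γ s‖ := by
    obtain ⟨s, hs, hmin⟩ := isCompact_Icc.exists_isMinOn (Set.nonempty_Icc.2 hn)
      (continuous_norm.comp hc).continuousOn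
    exact ⟨‖γ s‖, norm_pos_iff.2 (W.piecewiseLinear_ne_zero hs), fun x hx => hmin hx⟩
  set E := (fun x : ℝ × ℝ => x.1 • γ x.2) '' Set.Ici 1 ×ˢ Set.Icc 0 (n : ℝ) with hE
  have hEc : IsClosed E := by
    -- The curve has distance at least `d` from the origin, so near a given point only scalars up to
    -- `M` occur, and there `E` agrees with a compact set.
    refine isClosed_of_closure_subset fun z hz => ?_
    set M := (‖z‖ + 1) / d
    have hcomp : IsCompact ((fun x : ℝ × ℝ => x.1 • γ x.2) ''
        Set.Icc 1 M ×ˢ Set.Icc 0 (n : ℝ)) := (isCompact_Icc.prod isCompact_Icc).image (by fun_prop)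
    have hz' : z ∈ closure (Metric.ball z 1 ∩ E) :=
      Metric.isOpen_ball.inter_closure ⟨Metric.mem_ball_self one_pos, hz⟩
    have hsub : Metric.ball z 1 ∩ E ⊆ (fun x : ℝ × ℝ => x.1 • γ x.2) ''
        Set.Icc 1 M ×ˢ Set.Icc 0 (n : ℝ) := by
      rintro _ ⟨hb, ⟨⟨r, s⟩, ⟨hr, hs⟩, rfl⟩⟩
      refine ⟨(r, s), ⟨⟨hr, ?_⟩, hs⟩, rfl⟩
      have hr' : (1 : ℝ) ≤ r := hr
      have h1 : ‖r • γ s‖ < ‖z‖ + 1 := by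
        have := norm_sub_norm_le (r • γ s) z
        rw [Metric.mem_ball, dist_eq_norm] at hb
        linarith
      rw [norm_smul, Real.norm_eq_abs, abs_of_pos (by linarith)] at h1
      rw [le_div_iff₀ hd]
      nlinarith [hdγ s hs]
    obtain ⟨⟨r, s⟩, hrs, e⟩ := closure_minimal hsub hcomp.isClosed hz'
    exact ⟨(r, s), ⟨hrs.1.1, hrs.2⟩, e⟩
  have hcov : ∀ z ∉ (ofSeq n V).boundary ℝ, z ∈ Eᶜ ∪ Kᶜ := by
    intro z hz
    by_contra! hcon
    rw [Set.mem_union, not_or, Set.notMem_compl_iff, Set.notMem_compl_iff] at hcon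
    obtain ⟨⟨⟨r, s⟩, ⟨hr, hs⟩, rfl⟩, ⟨⟨r', s'⟩, ⟨hr', hs'⟩, e⟩⟩ := hcon
    have hr1 : (1 : ℝ) ≤ r := hr
    simp only at e hz hs hs' hr'
    rcases hr'.1.eq_or_lt with h0 | h0
    · rw [← h0, zero_smul] at e
      exact smul_ne_zero (by linarith) (W.piecewiseLinear_ne_zero hs) e.symm
    · have h1 := (W.eq_of_smul_eq_smul hs' hs h0 (by linarith) e).1
      have h2 : r = 1 := le_antisymm (h1 ▸ hr'.2) hr1
      rw [h2, one_smul, hB] at hz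
      exact hz ⟨s, hs, rfl⟩
  have hdisj : Eᶜ ∩ Kᶜ = ∅ := by
    rw [Set.eq_empty_iff_forall_notMem]
    rintro z ⟨hz1, hz2⟩
    by_cases h0 : z = 0
    · exact hz2 ⟨(0, 0), ⟨by simp, by simp⟩, by simp [h0]⟩
    · obtain ⟨r, hr, s, hs, e⟩ := W.exists_smul_piecewiseLinear h0
      rcases le_total r 1 with h | h
      · exact hz2 ⟨(r, s), ⟨⟨hr.le, h⟩, hs⟩, e.symm⟩
      · exact hz1 ⟨(r, s), ⟨h, hs⟩, e.symm⟩
  ext z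
  constructor
  · rintro (hz | hz)
    · rw [hB] at hz
      obtain ⟨s, hs, rfl⟩ := hz
      exact ⟨(1, s), ⟨by simp, hs⟩, by simp⟩
    · by_contra hzK
      obtain ⟨r, hr, s, hs, e⟩ : ∃ r > 0, ∃ s ∈ Set.Icc (0 : ℝ) n, z = (r : ℝ) • γ s := by
        refine W.exists_smul_piecewiseLinear fun h => hzK ?_
        exact ⟨(0, 0), ⟨by simp, by simp⟩, by simp [h]⟩
      have hr1 : 1 < r := by
        by_contra! h
        exact hzK ⟨(r, s), ⟨⟨hr.le, h⟩, hs⟩, e.symm⟩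
      -- From a point outside `K` the radial ray never meets the curve again, so its component is
      -- unbounded.
      have hray : (fun x : ℝ => x • γ s) '' Set.Ici r ⊆
          connectedComponentIn ((ofSeq n V).boundary ℝ)ᶜ z := by
        refine (isPreconnected_Ici.image _ (by fun_prop)).subset_connectedComponentIn
          ⟨r, Set.self_mem_Ici, e.symm⟩ ?_
        rintro _ ⟨x, hx, rfl⟩ hxB
        rw [hB] at hxB
        obtain ⟨s', hs', e'⟩ := hxB
        have hx' : r ≤ x := hx
        have := (W.eq_of_smul_eq_smul hs' hs one_pos (by linarith) (by rw [one_smul]; exact e')).1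
        linarith
      obtain ⟨M, hM⟩ := (hz.subset hray).exists_norm_le
      have hγ0 := hdγ s hs
      have h2 := hM _ ⟨max r ((|M| + 1) / d), Set.mem_Ici.2 (le_max_left _ _), rfl⟩
      rw [norm_smul, Real.norm_eq_abs, abs_of_pos (by positivity)] at h2
      have h3 : (|M| + 1) / d ≤ max r ((|M| + 1) / d) := le_max_right _ _
      rw [div_le_iff₀ hd] at h3
      nlinarith [le_abs_self M, (by positivity : 0 < max r ((|M| + 1) / d))]
  · intro hz
    by_cases hzB : z ∈ (ofSeq n V).boundary ℝ
    · exact .inl hzB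
    · refine .inr (hKc.isBounded.subset fun x hx => ?_)
      have hxB := connectedComponentIn_subset _ _ hx
      by_contra hxK
      -- A component that meets both `Eᶜ` and `Kᶜ` would be disconnected.
      have := isPreconnected_connectedComponentIn (F := ((ofSeq n V).boundary ℝ)ᶜ) (x := z)
        Eᶜ Kᶜ hEc.isOpen_compl hKc.isClosed.isOpen_compl
        (fun y hy => hcov y (connectedComponentIn_subset _ _ hy))
        ⟨z, mem_connectedComponentIn hzB, ?_⟩ ⟨x, hx, hxK⟩
      · rw [hdisj, Set.inter_empty] at this
        exact Set.not_nonempty_empty this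
      · rcases hcov z hzB with h | h
        · exact h
        · exact absurd hz h

end WindsOnce

/-! ### Foldings of the boundary to a tree, and their gluing relation -/

/-- An involution `σ` of the numbers `0, …, n - 1` of the edges of a polygonal curve folds the
curve to a tree: `H k` is the height of the vertex number `k` over the root of the tree, edges
number `i` and `σ i` are glued together in opposite directions. -/
structure IsFolding (n : ℕ) (σ H : ℕ → ℕ) : Prop where
  lt : ∀ i < n, σ i < n
  invol : ∀ i < n, σ (σ i) = i
  ne : ∀ i < n, σ i ≠ i
  height_lt : ∀ i < n, i < σ i → H i < H (i + 1)
  height_partner : ∀ i < n, i < σ i → H (σ i) = H (i + 1)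
  height_partner_succ : ∀ i < n, i < σ i → H (σ i + 1) = H i
  le_height : ∀ i < n, ∀ k, i < k → k ≤ σ i → H (i + 1) ≤ H k
  height_zero : H 0 = 0
  height_last : H n = 0

namespace IsFolding

variable {n : ℕ} {σ H : ℕ → ℕ}

/-- The height over the root as a function of the time. -/
noncomputable def height (n : ℕ) (H : ℕ → ℕ) : ℝ → ℝ :=
  piecewiseLinear n fun k => (H k : ℝ)

lemma continuous_height : Continuous (height n H) := continuous_piecewiseLinear _ _

lemma height_apply {k : ℕ} (hk : k < n) {t : ℝ} (ht : t ∈ Set.Icc (0 : ℝ) 1) :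
    height n H (k + t) = H k + t * (H (k + 1) - H k) :=
  piecewiseLinear_apply _ hk ht

lemma height_natCast {k : ℕ} (hk : k ≤ n) : height n H k = H k :=
  piecewiseLinear_natCast _ hk

lemma height_nonneg (hn : 0 < n) {s : ℝ} (hs : s ∈ Set.Icc (0 : ℝ) n) : 0 ≤ height n H s := by
  obtain ⟨k, hk, t, ht, rfl⟩ := exists_nat_add_of_mem_Icc hn hs
  rw [height_apply hk ht]
  have h1 : (0 : ℝ) ≤ H k := Nat.cast_nonneg _
  have h2 : (0 : ℝ) ≤ H (k + 1) := Nat.cast_nonneg _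
  nlinarith [ht.1, ht.2]

lemma height_fold (h : IsFolding n σ H) {e : ℕ} (he : e < n) (hlt : e < σ e) {t : ℝ}
    (ht : t ∈ Set.Icc (0 : ℝ) 1) : height n H (σ e + (1 - t)) = height n H (e + t) := by
  rw [height_apply he ht, height_apply (h.lt e he) ⟨by linarith [ht.2], by linarith [ht.1]⟩,
    h.height_partner e he hlt, h.height_partner_succ e he hlt]
  ring

/-- This is where the folding is noncrossing. Between a point of a rising edge and its partner, the
path finishes that edge, stays above its upper end by `le_height`, and comes down along the partner
edge. For `t = 1` strictness can fail, since the path may return to the upper end several times. -/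
lemma height_le_and_lt (h : IsFolding n σ H) {e : ℕ} (he : e < n) (hlt : e < σ e) {t : ℝ}
    (ht : t ∈ Set.Icc (0 : ℝ) 1) {u : ℝ} (hu : e + t ≤ u) (hu' : u ≤ σ e + (1 - t)) :
    height n H (e + t) ≤ height n H u ∧
      (e + t < u → u < σ e + (1 - t) → t < 1 → height n H (e + t) < height n H u) := by
  have hH : (H e : ℝ) + 1 ≤ H (e + 1) := by exact_mod_cast h.height_lt e he hlt
  have hj := h.lt e he
  rw [height_apply he ht]
  rcases le_total u (e + 1) with h1 | h1
  · obtain ⟨x, rfl⟩ : ∃ x, u = e + x := ⟨u - e, by ring⟩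
    rw [height_apply he ⟨by linarith [ht.1], by linarith⟩]
    exact ⟨by nlinarith, fun h2 _ _ => by nlinarith⟩
  rcases le_total (σ e : ℝ) u with h2 | h2
  · obtain ⟨x, rfl⟩ : ∃ x, u = σ e + x := ⟨u - σ e, by ring⟩
    rw [height_apply hj ⟨by linarith, by linarith [ht.1]⟩, h.height_partner e he hlt,
      h.height_partner_succ e he hlt]
    exact ⟨by nlinarith, fun _ h2 _ => by nlinarith⟩
  have key : (H (e + 1) : ℝ) ≤ height n H u := by
    rcases h2.eq_or_lt with rfl | h2
    · rw [height_natCast hj.le, h.height_partner e he hlt]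
    have hj' : (σ e : ℝ) < n := by exact_mod_cast hj
    obtain ⟨k, hk, x, hx, rfl⟩ := exists_nat_add_of_mem_Ico (n := n) (s := u)
      ⟨by linarith [ht.1, (Nat.cast_nonneg e : (0 : ℝ) ≤ e)], by linarith⟩
    have k1 : e < k := by
      have : (e : ℝ) < k := by linarith [hx.2]
      exact_mod_cast this
    have k2 : k < σ e := by
      have : (k : ℝ) < σ e := by linarith [hx.1]
      exact_mod_cast this
    rw [height_apply hk ⟨hx.1, hx.2.le⟩]
    have a1 : (H (e + 1) : ℝ) ≤ H k := by exact_mod_cast h.le_height e he k k1 k2.le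
    have a2 : (H (e + 1) : ℝ) ≤ H (k + 1) := by
      exact_mod_cast h.le_height e he (k + 1) (by omega) k2
    nlinarith [hx.1, hx.2]
  exact ⟨by nlinarith [ht.2], fun _ _ h3 => by nlinarith⟩

section Gluing

variable {V : ℕ → ℂ} {ρ θ : ℕ → ℝ}

lemma lineMap_eq (V : ℕ → ℂ) {k : ℕ} (hk : k < n) {t : ℝ} (ht : t ∈ Set.Icc (0 : ℝ) 1) :
    AffineMap.lineMap (V k) (V (k + 1)) t = piecewiseLinear n V (k + t) := by
  rw [piecewiseLinear_apply V hk ht, AffineMap.lineMap_apply_module']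
  abel

lemma lineMap_ite (V : ℕ → ℂ) {k : ℕ} (hk : k < n) (p : Prop) [Decidable p] {t : ℝ}
    (ht : t ∈ Set.Icc (0 : ℝ) 1) :
    AffineMap.lineMap (if p then V k else V (k + 1)) (if p then V (k + 1) else V k) t =
      piecewiseLinear n V (k + if p then t else 1 - t) := by
  split_ifs
  · exact lineMap_eq V hk ht
  · rw [← lineMap_eq V hk ⟨by linarith [ht.2], by linarith [ht.1]⟩,
      AffineMap.lineMap_apply_one_sub]

/-- The gluing of the boundary of a polygon that folds it to a tree. -/
def gluing (h : IsFolding n σ H) (W : WindsOnce n V ρ θ)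
    (hd : ∀ i < n, dist (V (σ i)) (V (σ i + 1)) = dist (V i) (V (i + 1))) :
    Gluing (ofSeq n V) where
  size := n
  -- The earlier edge of a pair is traversed forwards and the later one backwards, so that glued
  -- edges run in opposite directions along the boundary.
  start j := if (j : ℕ) < σ j then V j else V (j + 1)
  finish j := if (j : ℕ) < σ j then V (j + 1) else V j
  partner j := ⟨σ j, h.lt j j.2⟩
  start_ne_finish j := by
    have : V j ≠ V (j + 1) := by
      intro e
      have h1 := lineMap_eq V j.2 (t := 0) (by simp)
      have h2 := lineMap_eq V j.2 (t := 1 / 2) (by norm_num)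
      rw [← e, AffineMap.lineMap_same_apply] at h1 h2
      have := (W.eq_of_smul_eq j.2 j.2 (t := 0) (t' := 1 / 2) (by simp) (by norm_num) one_pos
        one_pos (by rw [← h1, ← h2])).2.2
      norm_num at this
    split_ifs
    · exact this
    · exact this.symm
  disjoint i j hij := by
    rw [Set.disjoint_left]
    intro z hz hz'
    rw [openSegment_eq_image_lineMap] at hz hz'
    obtain ⟨t, ht, rfl⟩ := hz
    obtain ⟨t', ht', e⟩ := hz'
    rw [lineMap_ite V i.2 _ ⟨ht.1.le, ht.2.le⟩, lineMap_ite V j.2 _ ⟨ht'.1.le, ht'.2.le⟩] at e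
    refine hij (Fin.ext (W.eq_of_smul_eq j.2 i.2 ?_ ?_ one_pos one_pos
      (congrArg ((1 : ℝ) • ·) e)).2.1.symm) <;> split_ifs
    · exact ⟨ht'.1.le, ht'.2⟩
    · exact ⟨by linarith [ht'.2], by linarith [ht'.1]⟩
    · exact ⟨ht.1.le, ht.2⟩
    · exact ⟨by linarith [ht.2], by linarith [ht.1]⟩
  cover := by
    rw [boundary]
    congr 1
    funext i
    rw [edgeSet, affineSegment_eq_segment, ofSeq_finRotate W.closed, ofSeq_apply]
    split_ifs
    · rfl
    · exact segment_symm _ _ _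
  partner_ne j e := h.ne j j.2 (Fin.val_eq_of_eq e)
  partner_partner j := Fin.ext (h.invol j j.2)
  dist_partner j := by
    have h1 := hd j j.2
    have h2 := h.ne j j.2
    have h3 := h.invol j j.2
    simp only [h3]
    rcases lt_or_gt_of_ne h2 with h4 | h4
    · rw [if_pos h4, if_pos h4, if_neg h4.not_gt, if_neg h4.not_gt, h1, dist_comm]
    · rw [if_neg h4.not_gt, if_neg h4.not_gt, if_pos h4, if_pos h4, dist_comm, h1]

variable (h : IsFolding n σ H) (W : WindsOnce n V ρ θ)
  (hd : ∀ i < n, dist (V (σ i)) (V (σ i + 1)) = dist (V i) (V (i + 1)))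

/-- In boundary parameters the gluing is `e + t ↦ σ e + (1 - t)` for both edges of a pair, which
removes the case distinction on their order. -/
lemma exists_gluing_iff (p q : ℂ) :
    (∃ j, ∃ t ∈ Set.Icc (0 : ℝ) 1,
      p = AffineMap.lineMap ((h.gluing W hd).start j) ((h.gluing W hd).finish j) t ∧
      q = AffineMap.lineMap ((h.gluing W hd).start ((h.gluing W hd).partner j))
        ((h.gluing W hd).finish ((h.gluing W hd).partner j)) t) ↔
    ∃ e < n, ∃ t ∈ Set.Icc (0 : ℝ) 1,
      p = piecewiseLinear n V (e + t) ∧ q = piecewiseLinear n V (σ e + (1 - t)) := by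
  have key : ∀ j : Fin n, ∀ t ∈ Set.Icc (0 : ℝ) 1,
      AffineMap.lineMap ((h.gluing W hd).start j) ((h.gluing W hd).finish j) t =
        piecewiseLinear n V (j + if (j : ℕ) < σ j then t else 1 - t) :=
    fun j t ht => lineMap_ite V j.2 _ ht
  have key' : ∀ j : Fin n, ∀ t ∈ Set.Icc (0 : ℝ) 1,
      AffineMap.lineMap ((h.gluing W hd).start ((h.gluing W hd).partner j))
        ((h.gluing W hd).finish ((h.gluing W hd).partner j)) t =
        piecewiseLinear n V (σ j + if σ j < j then t else 1 - t) := by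
    intro j t ht
    have := key ⟨σ j, h.lt j j.2⟩ t ht
    simp only [h.invol j j.2] at this
    exact this
  have hflip : ∀ t ∈ Set.Icc (0 : ℝ) 1, 1 - t ∈ Set.Icc (0 : ℝ) 1 := fun t ht =>
    ⟨by linarith [ht.2], by linarith [ht.1]⟩
  constructor
  · rintro ⟨j, t, ht, rfl, rfl⟩
    have hj : ((j : Fin n) : ℕ) < n := (j : Fin n).2
    rcases lt_or_gt_of_ne (h.ne (j : Fin n) hj) with h4 | h4
    · exact ⟨(j : Fin n), hj, 1 - t, hflip t ht, (key j t ht).trans (by rw [if_neg h4.not_gt]),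
        (key' j t ht).trans (by rw [if_pos h4, sub_sub_cancel])⟩
    · exact ⟨(j : Fin n), hj, t, ht, (key j t ht).trans (by rw [if_pos h4]),
        (key' j t ht).trans (by rw [if_neg h4.not_gt])⟩
  · rintro ⟨e, he, t, ht, rfl, rfl⟩
    rcases lt_or_gt_of_ne (h.ne e he) with h4 | h4
    · exact ⟨(⟨e, he⟩ : Fin n), 1 - t, hflip t ht,
        .trans (by simp [h4.not_gt]) (key ⟨e, he⟩ _ (hflip t ht)).symm,
        .trans (by simp [h4]) (key' ⟨e, he⟩ _ (hflip t ht)).symm⟩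
    · exact ⟨(⟨e, he⟩ : Fin n), t, ht, .trans (by simp [h4]) (key ⟨e, he⟩ t ht).symm,
        .trans (by simp [h4.not_gt]) (key' ⟨e, he⟩ t ht).symm⟩

lemma setoid_of_edge {e : ℕ} (he : e < n) {t : ℝ} (ht : t ∈ Set.Icc (0 : ℝ) 1) :
    (h.gluing W hd).setoid (piecewiseLinear n V (e + t))
      (piecewiseLinear n V (σ e + (1 - t))) :=
  Relation.EqvGen.rel _ _ ((exists_gluing_iff h W hd _ _).2 ⟨e, he, t, ht, rfl, rfl⟩)

lemma setoid_le {r : Setoid ℂ} (hr : ∀ e < n, ∀ t ∈ Set.Icc (0 : ℝ) 1,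
    r (piecewiseLinear n V (e + t)) (piecewiseLinear n V (σ e + (1 - t)))) :
    (h.gluing W hd).setoid ≤ r := by
  refine Setoid.eqvGen_le fun p q hpq => ?_
  obtain ⟨e, he, t, ht, rfl, rfl⟩ := (exists_gluing_iff h W hd p q).1 hpq
  exact hr e he t ht

/-- Closure under the gluing maps in one direction suffices, because the map of the edge `σ e`
inverts that of `e`. -/
lemma mem_of_setoid {S : Set ℂ} (hS : ∀ e < n, ∀ t ∈ Set.Icc (0 : ℝ) 1,
    piecewiseLinear n V (e + t) ∈ S → piecewiseLinear n V (σ e + (1 - t)) ∈ S) {p q : ℂ}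
    (hpq : (h.gluing W hd).setoid p q) (hp : p ∈ S) : q ∈ S := by
  have hle : (h.gluing W hd).setoid ≤ Setoid.ker (· ∈ S) := by
    refine setoid_le h W hd fun e he t ht => ?_
    refine propext ⟨hS e he t ht, fun hq => ?_⟩
    have := hS (σ e) (h.lt e he) (1 - t) ⟨by linarith [ht.2], by linarith [ht.1]⟩ hq
    rwa [h.invol e he, sub_sub_cancel] at this
  have := hle hpq
  rw [Setoid.ker_def] at this
  exact this ▸ hp

/-- The gluing maps send vertices to vertices and preserve `cls` on them, so the vertices of one
`cls` form a set that is closed under gluing. The condition at `n` accounts for the vertex `0` being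
passed twice. -/
lemma vertex_of_setoid {cls : ℕ → ℕ} (hcls : ∀ i < n, cls (σ i + 1) = cls i)
    (hcls' : cls n = cls 0) {i : ℕ} (hi : i < n) {q : ℂ}
    (hq : (h.gluing W hd).setoid (V i) q) : ∃ j < n, q = V j ∧ cls j = cls i := by
  have hV : ∀ j < n, piecewiseLinear n V (j + 0) = V j := fun j hj => by
    rw [add_zero, piecewiseLinear_natCast V hj.le]
  have hsucc : ∀ e < n, ∃ j < n, V (e + 1) = V j ∧ cls j = cls (e + 1) := by
    intro e he
    rcases Nat.lt_or_ge (e + 1) n with h1 | h1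
    · exact ⟨e + 1, h1, rfl, rfl⟩
    · have : e + 1 = n := by omega
      exact ⟨0, by omega, by rw [this, W.closed], by rw [this, hcls']⟩
  refine mem_of_setoid h W hd (S := {q | ∃ j < n, q = V j ∧ cls j = cls i}) ?_ hq ⟨i, hi, rfl, rfl⟩
  rintro e he t ht ⟨j, hj, e1, e2⟩
  have hs := h.lt e he
  rcases ht.2.lt_or_eq with ht1 | rfl
  · obtain ⟨-, rfl, rfl⟩ := W.eq_of_smul_eq he hj ⟨ht.1, ht1⟩ (t' := 0) (by simp) one_pos one_pos
      (by rw [e1, hV j hj])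
    obtain ⟨k, hk, e3, e4⟩ := hsucc _ hs
    refine ⟨k, hk, ?_, ?_⟩
    · rw [sub_zero, ← e3]
      exact_mod_cast piecewiseLinear_natCast V (show σ e + 1 ≤ n from hs)
    · rw [e4, hcls e he, e2]
  · obtain ⟨k, hk, e3, e4⟩ := hsucc _ he
    refine ⟨σ e, hs, ?_, ?_⟩
    · rw [sub_self, hV _ hs]
    · have e5 : piecewiseLinear n V ((e : ℝ) + 1) = V (e + 1) := by
        exact_mod_cast piecewiseLinear_natCast V (show e + 1 ≤ n from he)
      have e6 : k = j := (W.eq_of_smul_eq hk hj (t := 0) (t' := 0) (by simp) (by simp) one_pos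
        one_pos (by rw [hV k hk, hV j hj, ← e1, e5, e3])).2.1
      have e7 := hcls _ hs
      rw [h.invol e he] at e7
      rw [← e7, ← e4, e6, e2]

/-- An interior edge point is no end point of any edge, so only one gluing map reaches it; together
with its partner it is already closed under gluing. -/
lemma eq_or_eq_of_setoid {e : ℕ} (he : e < n) {t : ℝ} (ht : t ∈ Set.Ioo (0 : ℝ) 1) {q : ℂ}
    (hq : (h.gluing W hd).setoid (piecewiseLinear n V (e + t)) q) :
    q = piecewiseLinear n V (e + t) ∨ q = piecewiseLinear n V (σ e + (1 - t)) := by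
  have hI : ∀ x ∈ Set.Icc (0 : ℝ) 1, ∀ e < n, ∀ y ∈ Set.Ioo (0 : ℝ) 1, ∀ e' < n,
      piecewiseLinear n V (e + x) = piecewiseLinear n V (e' + y) → e = e' ∧ x = y := by
    intro x hx e he y hy e' he' heq
    rcases hx.2.lt_or_eq with h1 | rfl
    · exact (W.eq_of_smul_eq he he' ⟨hx.1, h1⟩ ⟨hy.1.le, hy.2⟩ one_pos one_pos (by rw [heq])).2
    · exfalso
      have e5 : piecewiseLinear n V ((e : ℝ) + 1) = V (e + 1) := by
        exact_mod_cast piecewiseLinear_natCast V (show e + 1 ≤ n from he)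
      obtain ⟨j, hj, e6⟩ : ∃ j < n, V (e + 1) = V j := by
        rcases Nat.lt_or_ge (e + 1) n with h1 | h1
        · exact ⟨e + 1, h1, rfl⟩
        · exact ⟨0, by omega, by rw [show e + 1 = n by omega, W.closed]⟩
      have := (W.eq_of_smul_eq hj he' (t := 0) (by simp) ⟨hy.1.le, hy.2⟩ one_pos one_pos
        (by rw [← heq, e5, add_zero, piecewiseLinear_natCast V hj.le, e6])).2.2
      exact hy.1.ne this
  refine mem_of_setoid h W hd
    (S := {piecewiseLinear n V (e + t), piecewiseLinear n V (σ e + (1 - t))}) ?_ hq (.inl rfl)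
  rintro e' he' t' ht' (h1 | h1)
  · obtain ⟨rfl, rfl⟩ := hI t' ht' e' he' t ht e he h1
    exact .inr rfl
  · obtain ⟨rfl, rfl⟩ := hI t' ht' e' he' (1 - t) ⟨by linarith [ht.2], by linarith [ht.1]⟩ (σ e)
      (h.lt e he) h1
    rw [h.invol e he, sub_sub_cancel]
    exact .inl rfl

/-- Points of equal height are glued together if the path between them does not go below. -/
lemma setoid_of_height_le {s s' : ℝ} (hs : s ∈ Set.Icc (0 : ℝ) n) (hs' : s' ≤ n)
    (hss : s ≤ s') (heq : height n H s = height n H s')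
    (hmin : ∀ u ∈ Set.Icc s s', height n H s ≤ height n H u) :
    (h.gluing W hd).setoid (piecewiseLinear n V s) (piecewiseLinear n V s') := by
  rcases hss.eq_or_lt with rfl | hlt
  · exact Setoid.refl' _ _
  obtain ⟨k, hk, t, ht, rfl⟩ := exists_nat_add_of_mem_Ico ⟨hs.1, hlt.trans_le hs'⟩
  -- Hop from the starting point to its partner, which is later on the boundary and has the same
  -- height, and repeat until `s'` is reached.
  induction hN : n - k using Nat.strong_induction_on generalizing k t with
  | h N ih =>
  have ht' : t ∈ Set.Icc (0 : ℝ) 1 := ⟨ht.1, ht.2.le⟩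
  have hj := h.lt k hk
  -- A falling edge would bring the path below its starting height immediately.
  have hup : k < σ k := by
    by_contra hcon
    have hlt' : σ k < k := lt_of_le_of_ne (not_lt.1 hcon) (h.ne k hk)
    have hi := h.invol k hk
    have a0 : σ k < σ (σ k) := by rw [hi]; exact hlt'
    have a1 := h.height_lt _ hj a0
    have a2 := h.height_partner _ hj a0
    have a3 := h.height_partner_succ _ hj a0
    rw [hi] at a2 a3
    rw [← a3, ← a2] at a1
    have a4 : (H (k + 1) : ℝ) < H k := by exact_mod_cast a1
    obtain ⟨x, hx, hx1, hx2⟩ : ∃ x, t < x ∧ x ≤ 1 ∧ k + x ≤ s' :=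
      ⟨min 1 (s' - k), lt_min ht.2 (by linarith), min_le_left _ _,
        by linarith [min_le_right 1 (s' - k)]⟩
    have := hmin (k + x) ⟨by linarith, hx2⟩
    rw [height_apply hk ht', height_apply hk ⟨by linarith [ht.1], hx1⟩] at this
    nlinarith
  -- If `s'` came before the partner, it would lie strictly inside the excursion and be strictly
  -- higher.
  have hs1 : (σ k : ℝ) + (1 - t) ≤ s' := by
    by_contra! hcon
    have := (h.height_le_and_lt hk hup ht' hss hcon.le).2 hlt hcon ht.2
    exact this.ne heq
  refine Setoid.trans' _ (h.setoid_of_edge W hd hk ht') ?_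
  have hfold := h.height_fold hk hup ht'
  have hkj : (k : ℝ) + 1 ≤ σ k := by exact_mod_cast hup
  rcases hs1.eq_or_lt with h1 | h1
  · rw [h1]
  have hmem : (σ k : ℝ) + (1 - t) ∈ Set.Ico (0 : ℝ) n :=
    ⟨by linarith [hs.1, ht.2], h1.trans_le hs'⟩
  obtain ⟨k1, hk1, t1, ht1, e1⟩ := exists_nat_add_of_mem_Ico hmem
  have hk' : k < k1 := by
    have : (k : ℝ) < k1 := by linarith [ht1.2, ht.2]
    exact_mod_cast this
  rw [e1] at h1 hfold hs1 hmem ⊢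
  refine ih (n - k1) (by omega) k1 hk1 t1 ht1 ⟨hmem.1, hmem.2.le⟩ hs1 (hfold.trans heq)
    (fun u hu => ?_) h1 rfl
  rw [hfold]
  exact hmin u ⟨by linarith [hu.1, ht.2], hu.2⟩

end Gluing

end IsFolding

/-! ### The surface of a folding is a sphere -/

namespace IsFolding

variable {n : ℕ} {σ H : ℕ → ℕ}

/-- The weighted length of the part of the path before the time `s` that is below the height `y`. -/
noncomputable def phase (n : ℕ) (H : ℕ → ℕ) (y s : ℝ) : ℝ :=
  ∫ u in (0 : ℝ)..s, max 0 (y - height n H u)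

lemma continuous_phase_integrand (y : ℝ) : Continuous fun u => max 0 (y - height n H u) :=
  continuous_const.max (continuous_const.sub continuous_height)

/-- The weight `max 0 (y - height)` depends continuously on `y`, unlike an indicator function; this
makes the phase jointly continuous in level and time. -/
lemma continuous_phase : Continuous fun x : ℝ × ℝ => phase n H x.1 x.2 := by
  refine intervalIntegral.continuous_parametric_intervalIntegral_of_continuous
    (f := fun (x : ℝ × ℝ) u => max 0 (x.1 - height n H u)) ?_ continuous_snd
  exact continuous_const.max ((continuous_fst.comp continuous_fst).sub
    (continuous_height.comp continuous_snd))

lemma phase_sub (y s s' : ℝ) : phase n H y s' - phase n H y s =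
    ∫ u in s..s', max 0 (y - height n H u) :=
  intervalIntegral.integral_interval_sub_left
    ((continuous_phase_integrand y).intervalIntegrable _ _)
    ((continuous_phase_integrand y).intervalIntegrable _ _)

lemma phase_zero (y : ℝ) : phase n H y 0 = 0 := by simp [phase]

lemma phase_mono (y : ℝ) : Monotone (phase n H y) := by
  intro s s' hss
  have := phase_sub (n := n) (H := H) y s s'
  have h2 : 0 ≤ ∫ u in s..s', max 0 (y - height n H u) :=
    intervalIntegral.integral_nonneg hss fun u _ => le_max_left _ _
  linarith

/-- Together with `phase_eq`: two times have the same phase at level `y` exactly when the path does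
not dip below `y` between them, which for boundary points of height `y` means being glued over one
excursion or several. -/
lemma phase_lt {y s s' : ℝ} (hss : s < s') {u : ℝ} (hu : u ∈ Set.Icc s s')
    (h : height n H u < y) : phase n H y s < phase n H y s' := by
  have := phase_sub (n := n) (H := H) y s s'
  have h2 : 0 < ∫ u in s..s', max 0 (y - height n H u) :=
    intervalIntegral.integral_pos hss (continuous_phase_integrand y).continuousOn
      (fun u _ => le_max_left _ _) ⟨u, hu, lt_max_of_lt_right (by linarith)⟩
  linarith

lemma phase_eq {y s s' : ℝ} (hss : s ≤ s') (h : ∀ u ∈ Set.Icc s s', y ≤ height n H u) :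
    phase n H y s = phase n H y s' := by
  have := phase_sub (n := n) (H := H) y s s'
  rw [intervalIntegral.integral_congr (g := fun _ => 0) fun u hu => ?_] at this
  · simp only [intervalIntegral.integral_zero] at this
    linarith
  · rw [Set.uIcc_of_le hss] at hu
    exact max_eq_left (by linarith [h u hu])

/-- A strict upper bound of the heights. -/
def top (n : ℕ) (H : ℕ → ℕ) : ℝ := 1 + ∑ k ∈ Finset.range (n + 1), (H k : ℝ)

lemma top_pos : 0 < top n H :=
  add_pos_of_pos_of_nonneg one_pos (Finset.sum_nonneg fun _ _ => Nat.cast_nonneg _)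

lemma height_lt_top (hn : 0 < n) {s : ℝ} (hs : s ∈ Set.Icc (0 : ℝ) n) :
    height n H s < top n H := by
  have key : ∀ k ≤ n, (H k : ℝ) < top n H := fun k hk => by
    have := Finset.single_le_sum (f := fun k => (H k : ℝ)) (fun _ _ => Nat.cast_nonneg _)
      (Finset.mem_range.2 (Nat.lt_succ_of_le hk))
    simp only [top]
    linarith
  obtain ⟨k, hk, t, ht, rfl⟩ := exists_nat_add_of_mem_Icc hn hs
  rw [height_apply hk ht]
  have h1 := key k hk.le
  have h2 := key (k + 1) hk
  rcases ht.2.lt_or_eq with h3 | rfl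
  · nlinarith [mul_pos (sub_pos.2 h3) (sub_pos.2 h1), mul_nonneg ht.1 (sub_pos.2 h2).le]
  · linarith

/-- The height over the root, extended from the boundary to the cone over it. -/
noncomputable def level (n : ℕ) (H : ℕ → ℕ) (x : ℝ × ℝ) : ℝ :=
  top n H - x.1 * (top n H - height n H x.2)

lemma continuous_level : Continuous (level n H) :=
  continuous_const.sub (continuous_fst.mul
    (continuous_const.sub (continuous_height.comp continuous_snd)))

lemma height_le_level (hn : 0 < n) {x : ℝ × ℝ} (hx : x ∈ Set.Icc (0 : ℝ) 1 ×ˢ Set.Icc 0 (n : ℝ)) :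
    height n H x.2 ≤ level n H x ∧ level n H x ≤ top n H := by
  have h1 := height_lt_top (H := H) hn hx.2
  have := hx.1.1
  have := hx.1.2
  unfold level
  constructor <;> nlinarith

lemma fst_eq_one_of_level (hn : 0 < n) {x : ℝ × ℝ}
    (hx : x ∈ Set.Icc (0 : ℝ) 1 ×ˢ Set.Icc 0 (n : ℝ)) (h : level n H x ≤ height n H x.2) :
    x.1 = 1 := by
  have h1 := height_lt_top (H := H) hn hx.2
  have h2 := hx.1.2
  unfold level at h
  by_contra hne
  have := lt_of_le_of_ne h2 hne
  nlinarith

lemma level_nonneg (hn : 0 < n) {x : ℝ × ℝ}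
    (hx : x ∈ Set.Icc (0 : ℝ) 1 ×ˢ Set.Icc 0 (n : ℝ)) : 0 ≤ level n H x :=
  (height_nonneg hn hx.2).trans (height_le_level hn hx).1

lemma level_one (s : ℝ) : level n H (1, s) = height n H s := by simp [level]

/-- The point with the height `2 u - 1` and the longitude `2 π p` of the unit sphere. -/
noncomputable def spherePoint (u p : ℝ) : ℂ × ℝ :=
  ((2 * √(u * (1 - u)) : ℝ) * Complex.exp ((2 * Real.pi * p : ℝ) * Complex.I), 2 * u - 1)

lemma spherePoint_mem {u : ℝ} (hu : u ∈ Set.Icc (0 : ℝ) 1) (p : ℝ) :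
    ‖(spherePoint u p).1‖ ^ 2 + (spherePoint u p).2 ^ 2 = 1 := by
  have h : 0 ≤ u * (1 - u) := mul_nonneg hu.1 (by linarith [hu.2])
  simp only [spherePoint, norm_mul, Complex.norm_exp_ofReal_mul_I, Complex.norm_real, mul_one,
    Real.norm_eq_abs, sq_abs, mul_pow, Real.sq_sqrt h]
  ring

lemma spherePoint_of_mul_eq_zero {u : ℝ} (hu : u * (1 - u) = 0) (p q : ℝ) :
    spherePoint u p = spherePoint u q := by
  simp [spherePoint, hu]

/-- The map of the cone over the boundary to the sphere that is constant on the classes of points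
that are glued together. -/
noncomputable def toSphere (n : ℕ) (H : ℕ → ℕ) (x : ℝ × ℝ) : ℂ × ℝ :=
  spherePoint (level n H x / top n H)
    (phase n H (level n H x) x.2 / phase n H (level n H x) n)

lemma toSphere_congr {x x' : ℝ × ℝ} (h1 : level n H x = level n H x')
    (h2 : phase n H (level n H x) x.2 = phase n H (level n H x) x'.2) :
    toSphere n H x = toSphere n H x' := by
  rw [toSphere, h2, h1, toSphere]

lemma level_div_top_mem (hn : 0 < n) {x : ℝ × ℝ}
    (hx : x ∈ Set.Icc (0 : ℝ) 1 ×ˢ Set.Icc 0 (n : ℝ)) :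
    level n H x / top n H ∈ Set.Icc (0 : ℝ) 1 :=
  ⟨div_nonneg (level_nonneg hn hx) top_pos.le,
    (div_le_one top_pos).2 (height_le_level hn hx).2⟩

variable (h : IsFolding n σ H)

include h in
lemma height_at_zero : height n H 0 = 0 := by
  have := height_natCast (H := H) (Nat.zero_le n)
  rw [Nat.cast_zero, h.height_zero] at this
  simpa using this

include h in
lemma height_at_last : height n H n = 0 := by
  rw [height_natCast le_rfl, h.height_last, Nat.cast_zero]

include h in
lemma phase_pos {y s : ℝ} (hy : 0 < y) (hs : 0 < s) : 0 < phase n H y s := by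
  have := phase_lt (n := n) (H := H) (y := y) hs (u := 0) ⟨le_rfl, hs.le⟩
    (by rwa [h.height_at_zero])
  rwa [phase_zero] at this

include h in
lemma phase_lt_last {y s : ℝ} (hy : 0 < y) (hs : s < n) : phase n H y s < phase n H y n :=
  phase_lt hs (u := n) ⟨hs.le, le_rfl⟩ (by rwa [h.height_at_last])

include h in
-- At level `0` the normalized phase degenerates, but there the radius of the circle of latitude
-- tends to `0`, so the longitude does not matter. At positive levels the total phase is positive.
lemma continuousAt_toSphere (hn : 0 < n) {x : ℝ × ℝ}
    (hx : x ∈ Set.Icc (0 : ℝ) 1 ×ˢ Set.Icc 0 (n : ℝ)) : ContinuousAt (toSphere n H) x := by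
  have hl := continuous_level (n := n) (H := H)
  have hn' : (0 : ℝ) < n := by exact_mod_cast hn
  refine ContinuousAt.prodMk ?_ (by fun_prop)
  have hrad : Continuous fun x => 2 * √(level n H x / top n H * (1 - level n H x / top n H)) := by
    fun_prop
  rcases (level_nonneg (H := H) hn hx).eq_or_lt with h0 | h0
  · rw [ContinuousAt]
    simp only [← h0, zero_div, zero_mul, Real.sqrt_zero, mul_zero, Complex.ofReal_zero]
    rw [tendsto_zero_iff_norm_tendsto_zero]
    have := hrad.norm.tendsto x
    simp only [← h0, zero_div, zero_mul, Real.sqrt_zero, mul_zero, norm_zero] at this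
    refine this.congr fun x' => ?_
    conv_rhs => rw [norm_mul, Complex.norm_exp_ofReal_mul_I, mul_one, Complex.norm_real]
  · have c1 : Continuous fun x : ℝ × ℝ => phase n H (level n H x) x.2 :=
      continuous_phase.comp (hl.prodMk continuous_snd)
    have c2 : Continuous fun x : ℝ × ℝ => phase n H (level n H x) n :=
      continuous_phase.comp (hl.prodMk continuous_const)
    have c3 := c1.continuousAt.div c2.continuousAt (h.phase_pos h0 hn').ne'
    have c4 : ContinuousAt (fun x : ℝ × ℝ => ((2 * Real.pi * (phase n H (level n H x) x.2 /
        phase n H (level n H x) n) : ℝ) : ℂ)) x :=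
      Complex.continuous_ofReal.continuousAt.comp (continuousAt_const.mul c3)
    exact (Complex.continuous_ofReal.comp hrad).continuousAt.mul
      (Complex.continuous_exp.continuousAt.comp (c4.mul continuousAt_const))

include h in
lemma toSphere_zero_eq_last (r : ℝ) : toSphere n H (r, 0) = toSphere n H (r, (n : ℝ)) := by
  have hl : level n H (r, 0) = level n H (r, (n : ℝ)) := by
    simp only [level, h.height_at_zero, h.height_at_last]
  rcases eq_or_ne (phase n H (level n H (r, (n : ℝ))) n) 0 with h0 | h0
  · exact toSphere_congr hl (by simp only [hl, phase_zero, h0])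
  · simp only [toSphere, hl, phase_zero, zero_div, div_self h0, spherePoint]
    congr 2
    simp

include h in
-- Partners have equal height, and the path between them does not go below it, so no phase
-- accumulates.
lemma toSphere_edge {e : ℕ} (he : e < n) {t : ℝ} (ht : t ∈ Set.Icc (0 : ℝ) 1) :
    toSphere n H (1, e + t) = toSphere n H (1, σ e + (1 - t)) := by
  have key : ∀ e < n, e < σ e → ∀ t ∈ Set.Icc (0 : ℝ) 1,
      toSphere n H (1, e + t) = toSphere n H (1, σ e + (1 - t)) := by
    intro e he hlt t ht
    have hkj : (e : ℝ) + 1 ≤ σ e := by exact_mod_cast hlt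
    refine toSphere_congr ?_ ?_
    · rw [level_one, level_one, h.height_fold he hlt ht]
    · refine phase_eq (by simp only; linarith [ht.2]) fun u hu => ?_
      rw [level_one]
      exact (h.height_le_and_lt he hlt ht hu.1 hu.2).1
  rcases lt_or_gt_of_ne (h.ne e he) with h1 | h1
  · have := key (σ e) (h.lt e he) (by rwa [h.invol e he]) (1 - t)
      ⟨by linarith [ht.2], by linarith [ht.1]⟩
    rw [h.invol e he, sub_sub_cancel] at this
    exact this.symm
  · exact key e he h1 t ht

include h in
lemma exists_toSphere_eq (hn : 0 < n) {z : ℂ} {τ : ℝ} (hz : ‖z‖ ^ 2 + τ ^ 2 = 1) :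
    ∃ x ∈ Set.Icc (0 : ℝ) 1 ×ˢ Set.Icc 0 (n : ℝ), toSphere n H x = (z, τ) := by
  have hY := top_pos (n := n) (H := H)
  have hn' : (0 : ℝ) < n := by exact_mod_cast hn
  set y := top n H * ((τ + 1) / 2) with hy
  have hτ1 : -1 ≤ τ := by nlinarith [sq_nonneg ‖z‖]
  have hτ2 : τ ≤ 1 := by nlinarith [sq_nonneg ‖z‖]
  have hyτ : y / top n H = (τ + 1) / 2 := by rw [hy]; field_simp
  have hnorm : 2 * √((τ + 1) / 2 * (1 - (τ + 1) / 2)) = ‖z‖ := by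
    rw [show (τ + 1) / 2 * (1 - (τ + 1) / 2) = (‖z‖ / 2) ^ 2 by linear_combination -hz / 4,
      Real.sqrt_sq (by positivity)]
    ring
  have hsuff : ∀ x ∈ Set.Icc (0 : ℝ) 1 ×ˢ Set.Icc 0 (n : ℝ), level n H x = y →
      z = ‖z‖ * Complex.exp ((2 * Real.pi * (phase n H y x.2 / phase n H y n) : ℝ) * Complex.I) →
      ∃ x ∈ Set.Icc (0 : ℝ) 1 ×ˢ Set.Icc 0 (n : ℝ), toSphere n H x = (z, τ) := by
    intro x hx h1 h2
    refine ⟨x, hx, ?_⟩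
    rw [toSphere, h1, spherePoint, hyτ, hnorm, ← h2]
    congr 1
    ring
  rcases hτ2.eq_or_lt with h1 | h1
  · have hz0 : z = 0 := by
      rw [h1] at hz
      simpa using hz
    exact hsuff (0, 0) ⟨by simp, by simp⟩ (by simp [level, hy, h1]) (by simp [hz0])
  rcases hτ1.eq_or_lt with h2 | h2
  · have hz0 : z = 0 := by
      rw [← h2] at hz
      simpa using hz
    exact hsuff (1, 0) ⟨by simp, by simp⟩ (by simp [level, hy, ← h2, h.height_at_zero])
      (by simp [hz0])
  have hy0 : 0 < y := mul_pos hY (by linarith)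
  have hyY : y < top n H := by rw [hy]; nlinarith
  have hA := h.phase_pos (y := y) hy0 hn'
  set ψ := toIcoMod Real.two_pi_pos 0 z.arg with hψ
  have hmem : ψ ∈ Set.Ico 0 (0 + 2 * Real.pi) := toIcoMod_mem_Ico _ _ _
  have hzψ : z = ‖z‖ * Complex.exp (ψ * Complex.I) := by
    have hper : Complex.exp (ψ * Complex.I) = Complex.exp (z.arg * Complex.I) := by
      rw [Complex.exp_eq_exp_iff_exists_int]
      refine ⟨-toIcoDiv Real.two_pi_pos 0 z.arg, ?_⟩
      rw [hψ, toIcoMod]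
      push_cast
      simp only [zsmul_eq_mul]
      ring
    rw [hper, Complex.norm_mul_exp_arg_mul_I]
  set v := phase n H y n * (ψ / (2 * Real.pi)) with hv
  have hv0 : 0 ≤ v := mul_nonneg hA.le (div_nonneg hmem.1 Real.two_pi_pos.le)
  have hv1 : v ≤ phase n H y n :=
    mul_le_of_le_one_right hA.le ((div_le_one Real.two_pi_pos).2 (by linarith [hmem.2]))
  have hcont : Continuous (phase n H y) :=
    continuous_phase.comp (continuous_const.prodMk continuous_id)
  -- Take the earliest such time: if the height there exceeded `y`, the phase would be constant
  -- slightly before it and an earlier time would do.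
  obtain ⟨s, ⟨hs, hsv⟩, hleast⟩ : ∃ s, IsLeast {s | s ∈ Set.Icc (0 : ℝ) n ∧ phase n H y s = v} s := by
    refine IsCompact.exists_isLeast
      (isCompact_Icc.inter_right (isClosed_eq hcont continuous_const)) ?_
    obtain ⟨s, hs, e⟩ := intermediate_value_Icc hn'.le hcont.continuousOn
      ⟨by rwa [phase_zero], hv1⟩
    exact ⟨s, hs, e⟩
  have hhs : height n H s ≤ y := by
    by_contra! hcon
    have hs0 : 0 < s := by
      rcases hs.1.eq_or_lt with h0 | h0
      · rw [← h0, h.height_at_zero] at hcon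
        linarith
      · exact h0
    have hev := continuous_height.continuousAt.eventually (lt_mem_nhds hcon)
    obtain ⟨ε, hε, hball⟩ := Metric.eventually_nhds_iff.1 hev
    set s' := max 0 (s - ε / 2)
    have hs' : s' < s := max_lt hs0 (by linarith)
    have hs'' : s - ε / 2 ≤ s' := le_max_right _ _
    have hs0' : 0 ≤ s' := le_max_left _ _
    have := phase_eq (n := n) (H := H) (y := y) hs'.le fun u hu => (hball (by
      rw [Real.dist_eq, abs_lt]; constructor <;> linarith [hu.1, hu.2])).le
    exact (hleast ⟨⟨hs0', hs'.le.trans hs.2⟩, this.trans hsv⟩).not_gt hs'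
  have hht := height_lt_top (H := H) hn hs
  have hden : 0 < top n H - height n H s := by linarith
  refine hsuff ((top n H - y) / (top n H - height n H s), s) ⟨⟨by
    have : 0 ≤ top n H - y := by linarith
    positivity, (div_le_one hden).2 (by linarith)⟩, hs⟩ ?_ ?_
  · simp only [level]
    field_simp
    ring
  · simp only [hsv, hv]
    rw [mul_div_cancel_left₀ _ hA.ne', mul_div_cancel₀ _ Real.two_pi_pos.ne']
    exact hzψ

section Surface

variable {V : ℕ → ℂ} {ρ θ : ℕ → ℝ} (W : WindsOnce n V ρ θ)
  (hd : ∀ i < n, dist (V (σ i)) (V (σ i + 1)) = dist (V i) (V (i + 1)))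

include h W in
-- The cone parametrization is ambiguous only at the center, which goes to a pole, and along the
-- seam, where the times `0` and `n` give the same point of the sphere.
lemma toSphere_eq_of_smul_eq {x x' : ℝ × ℝ} (hx : x ∈ Set.Icc (0 : ℝ) 1 ×ˢ Set.Icc 0 (n : ℝ))
    (hx' : x' ∈ Set.Icc (0 : ℝ) 1 ×ˢ Set.Icc 0 (n : ℝ))
    (e : x.1 • piecewiseLinear n V x.2 = x'.1 • piecewiseLinear n V x'.2) :
    toSphere n H x = toSphere n H x' := by
  obtain ⟨r, s⟩ := x
  obtain ⟨r', s'⟩ := x'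
  have key : ∀ s s', toSphere n H (0, s) = toSphere n H (0, s') := by
    intro s s'
    have hY := top_pos (n := n) (H := H)
    simp only [toSphere, level, zero_mul, sub_zero, div_self hY.ne']
    exact spherePoint_of_mul_eq_zero (by simp) _ _
  simp only at e
  rcases hx.1.1.eq_or_lt with h0 | h0
  · simp only at h0
    subst h0
    rw [zero_smul, eq_comm, smul_eq_zero, or_iff_left (W.piecewiseLinear_ne_zero hx'.2)] at e
    rw [e]
    exact key _ _
  rcases hx'.1.1.eq_or_lt with h0' | h0'
  · simp only at h0'
    subst h0'
    rw [zero_smul, smul_eq_zero, or_iff_left (W.piecewiseLinear_ne_zero hx.2)] at e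
    exact absurd e h0.ne'
  obtain ⟨h1, h2⟩ := W.eq_of_smul_eq_smul hx.2 hx'.2 h0 h0' e
  simp only at h1 h2
  subst h1
  rcases h2 with rfl | ⟨rfl, rfl⟩ | ⟨rfl, rfl⟩
  · rfl
  · exact h.toSphere_zero_eq_last r
  · exact (h.toSphere_zero_eq_last r).symm

include W in
-- Equal images have equal levels. Away from the poles their phases differ by an integer multiple of
-- the total: multiple zero means no dip between them, so they coincide or are glued boundary
-- points; otherwise they are the two ends of the seam. At the lower pole all points have height
-- zero and are glued together, and at the upper pole both are the center.
lemma setoid_of_toSphere_eq {x x' : ℝ × ℝ} (hx : x ∈ Set.Icc (0 : ℝ) 1 ×ˢ Set.Icc 0 (n : ℝ))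
    (hx' : x' ∈ Set.Icc (0 : ℝ) 1 ×ˢ Set.Icc 0 (n : ℝ)) (e : toSphere n H x = toSphere n H x') :
    (h.gluing W hd).setoid (x.1 • piecewiseLinear n V x.2)
      (x'.1 • piecewiseLinear n V x'.2) := by
  wlog hss : x.2 ≤ x'.2 generalizing x x'
  · exact Setoid.symm' _ (this hx' hx e.symm (le_of_not_ge hss))
  have hn := W.n_pos
  have hn' : (0 : ℝ) < n := by exact_mod_cast hn
  have hY := top_pos (n := n) (H := H)
  have hlev : level n H x = level n H x' := by
    have := congrArg Prod.snd e
    simp only [toSphere, spherePoint] at this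
    have h2 : level n H x / top n H = level n H x' / top n H := by linarith
    exact (div_left_inj' hY.ne').1 h2
  have h0 := level_nonneg (H := H) hn hx
  have hle := height_le_level (H := H) hn hx
  have hle' := height_le_level (H := H) hn hx'
  rw [← hlev] at hle'
  have hbdry : level n H x ≤ height n H x.2 → level n H x ≤ height n H x'.2 →
      (∀ u ∈ Set.Icc x.2 x'.2, level n H x ≤ height n H u) →
      (h.gluing W hd).setoid (x.1 • piecewiseLinear n V x.2)
        (x'.1 • piecewiseLinear n V x'.2) := by
    intro h1 h1' hu
    rw [fst_eq_one_of_level hn hx h1, fst_eq_one_of_level hn hx' (hlev ▸ h1'), one_smul, one_smul]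
    exact h.setoid_of_height_le W hd hx.2 hx'.2.2 hss (by linarith) fun u hu' =>
      hle.1.trans (hu u hu')
  rcases h0.eq_or_lt with h1 | h1
  · rw [← h1] at hbdry
    exact hbdry (height_nonneg hn hx.2) (height_nonneg hn hx'.2) fun u hu =>
      height_nonneg hn ⟨hx.2.1.trans hu.1, hu.2.trans hx'.2.2⟩
  rcases hle.2.eq_or_lt with h2 | h2
  · have key : ∀ x ∈ Set.Icc (0 : ℝ) 1 ×ˢ Set.Icc 0 (n : ℝ), level n H x = top n H →
        x.1 = 0 := by
      intro x hx hl
      have h3 := height_lt_top (H := H) hn hx.2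
      have h4 : x.1 * (top n H - height n H x.2) = 0 := by
        unfold level at hl
        linarith
      rcases mul_eq_zero.1 h4 with h5 | h5
      · exact h5
      · linarith
    rw [key x hx h2, key x' hx' (hlev ▸ h2), zero_smul, zero_smul]
  have hA := h.phase_pos h1 hn'
  have hexp := congrArg Prod.fst e
  simp only [toSphere, spherePoint, ← hlev] at hexp
  have hu1 : 0 < level n H x / top n H := by positivity
  have hu2 : level n H x / top n H < 1 := (div_lt_one hY).2 h2
  have hrad : 0 < 2 * √(level n H x / top n H * (1 - level n H x / top n H)) :=
    mul_pos two_pos (Real.sqrt_pos.2 (mul_pos hu1 (by linarith)))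
  obtain ⟨k, hk⟩ := Complex.exp_eq_exp_iff_exists_int.1
    (mul_left_cancel₀ (Complex.ofReal_ne_zero.2 hrad.ne') hexp)
  set y := level n H x
  have hk' : phase n H y x.2 = phase n H y x'.2 + k * phase n H y n := by
    have := congrArg Complex.im hk
    simp only [Complex.mul_I_im, Complex.add_im, Complex.ofReal_re] at this
    have h3 : (((k : ℂ) * (2 * Real.pi * Complex.I)).im) = k * (2 * Real.pi) := by simp
    rw [h3] at this
    have h4 : phase n H y x.2 / phase n H y n = phase n H y x'.2 / phase n H y n + k := by
      have := Real.pi_pos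
      apply mul_left_cancel₀ (Real.two_pi_pos.ne')
      linarith
    field_simp at h4
    linarith
  have hm := phase_mono (n := n) (H := H) y hss
  have hm0 := phase_mono (n := n) (H := H) y hx.2.1
  have hm1 := phase_mono (n := n) (H := H) y hx'.2.2
  rw [phase_zero] at hm0
  rcases eq_or_ne k 0 with rfl | hk0
  · simp only [Int.cast_zero, zero_mul, add_zero] at hk'
    have hu : x.2 < x'.2 → ∀ u ∈ Set.Icc x.2 x'.2, y ≤ height n H u := fun hlt u hu => by
      by_contra! hcon
      exact (phase_lt hlt hu hcon).ne hk'
    rcases hss.eq_or_lt with h3 | h3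
    · have : x = x' := by
        refine Prod.ext ?_ h3
        have h4 := height_lt_top (H := H) hn hx.2
        have h5 : level n H x = level n H x' := hlev
        unfold level at h5
        rw [← h3] at h5
        have h6 : (x.1 - x'.1) * (top n H - height n H x.2) = 0 := by linarith
        rcases mul_eq_zero.1 h6 with h7 | h7 <;> linarith
      rw [this]
    · exact hbdry (hu h3 _ ⟨le_rfl, hss⟩) (hu h3 _ ⟨hss, le_rfl⟩) (hu h3)
  · have hk1 : (k : ℝ) ≤ -1 := by
      have : k < 0 := by
        have : (k : ℝ) < 1 := by
          by_contra! hcon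
          nlinarith
        have : k < 1 := by exact_mod_cast this
        omega
      exact_mod_cast (show k ≤ -1 by omega)
    have h3 : phase n H y x.2 = 0 := by nlinarith
    have h4 : phase n H y x'.2 = phase n H y n := by nlinarith
    have h5 : x.2 = 0 := by
      by_contra hne
      exact (h.phase_pos h1 (lt_of_le_of_ne hx.2.1 (Ne.symm hne))).ne' h3
    have h6 : x'.2 = n := by
      by_contra hne
      exact (h.phase_lt_last h1 (lt_of_le_of_ne hx'.2.2 hne)).ne h4
    have h7 : x.1 = x'.1 := by
      have h8 : level n H x = level n H x' := hlev
      simp only [level, h5, h6, h.height_at_zero, h.height_at_last, sub_zero] at h8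
      exact mul_right_cancel₀ hY.ne' (by linarith)
    have e0 : piecewiseLinear n V 0 = V 0 := by
      simpa using piecewiseLinear_natCast V (Nat.zero_le n)
    rw [h5, h6, h7, e0, piecewiseLinear_natCast V le_rfl, W.closed]

/-- The surface that is obtained by folding the boundary to a tree is a sphere. -/
theorem nonempty_surface_homeomorph :
    Nonempty ((h.gluing W hd).Surface ≃ₜ Metric.sphere (0 : EuclideanSpace ℝ (Fin 3)) 1) := by
  have hn := W.n_pos
  let X := (Set.Icc (0 : ℝ) 1 ×ˢ Set.Icc 0 (n : ℝ) : Set (ℝ × ℝ))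
  have : CompactSpace X := isCompact_iff_compactSpace.1 (isCompact_Icc.prod isCompact_Icc)
  let toE : ℂ × ℝ → EuclideanSpace ℝ (Fin 3) := fun w => !₂[w.1.re, w.1.im, w.2]
  have htoE : Continuous toE := by
    refine (PiLp.continuous_toLp 2 _).comp (continuous_pi fun i => ?_)
    fin_cases i
    · exact Complex.continuous_re.comp continuous_fst
    · exact Complex.continuous_im.comp continuous_fst
    · exact continuous_snd
  have hnorm : ∀ w, ‖toE w‖ ^ 2 = ‖w.1‖ ^ 2 + w.2 ^ 2 := fun w => by
    rw [EuclideanSpace.norm_sq_eq, Fin.sum_univ_three, Complex.sq_norm, Complex.normSq_apply]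
    simp [toE, sq]
  have hinj : Function.Injective toE := fun w w' e => by
    have h0 : w.1.re = w'.1.re := congrArg (fun v : EuclideanSpace ℝ (Fin 3) => v 0) e
    have h1 : w.1.im = w'.1.im := congrArg (fun v : EuclideanSpace ℝ (Fin 3) => v 1) e
    have h2 : w.2 = w'.2 := congrArg (fun v : EuclideanSpace ℝ (Fin 3) => v 2) e
    exact Prod.ext (Complex.ext h0 h1) h2
  let F : X → Metric.sphere (0 : EuclideanSpace ℝ (Fin 3)) 1 := fun x =>
    ⟨toE (toSphere n H x), by
      rw [mem_sphere_zero_iff_norm, ← sq_eq_sq₀ (norm_nonneg _) zero_le_one, hnorm, one_pow]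
      exact spherePoint_mem (level_div_top_mem hn x.2) _⟩
  have hF : Continuous F := by
    refine Continuous.subtype_mk (htoE.comp (continuous_iff_continuousAt.2 fun x => ?_)) _
    exact (h.continuousAt_toSphere hn x.2).comp continuous_subtype_val.continuousAt
  have hFs : Function.Surjective F := by
    rintro ⟨v, hv⟩
    have hve : toE (⟨v 0, v 1⟩, v 2) = v := by
      ext i
      fin_cases i <;> rfl
    rw [mem_sphere_zero_iff_norm] at hv
    obtain ⟨x, hx, e⟩ := h.exists_toSphere_eq hn (z := ⟨v 0, v 1⟩) (τ := v 2) (by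
      have := hnorm (⟨v 0, v 1⟩, v 2)
      rw [hve, hv, one_pow] at this
      exact this.symm)
    exact ⟨⟨x, hx⟩, Subtype.ext ((congrArg toE e).trans hve)⟩
  let q : X → (ofSeq n V).region := fun x => ⟨x.1.1 • piecewiseLinear n V x.1.2, by
    rw [W.region_eq]
    exact ⟨x, x.2, rfl⟩⟩
  have hq : Continuous q := by
    have := continuous_piecewiseLinear n V
    exact Continuous.subtype_mk (by fun_prop) _
  have hqs : Function.Surjective q := by
    rintro ⟨z, hz⟩
    rw [W.region_eq] at hz
    obtain ⟨x, hx, rfl⟩ := hz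
    exact ⟨⟨x, hx⟩, rfl⟩
  have hqq := hq.isClosedMap.isQuotientMap hq hqs
  have hFq := hF.isClosedMap.isQuotientMap hF hFs
  let mk : (ofSeq n V).region → (h.gluing W hd).Surface :=
    @Quotient.mk _ (Setoid.comap Subtype.val (h.gluing W hd).setoid)
  have hmk : Topology.IsQuotientMap (mk ∘ q) := Topology.IsQuotientMap.comp isQuotientMap_quot_mk hqq
  -- The surface and the sphere are both quotients of the compact cone `X`; they agree once the two
  -- maps have the same fibers.
  have hker : Setoid.ker (mk ∘ q) = Setoid.ker F := by
    ext x x'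
    rw [Setoid.ker_def, Setoid.ker_def]
    refine (Quotient.eq (r := Setoid.comap Subtype.val (h.gluing W hd).setoid)).trans ?_
    have hFt : F x = F x' ↔ toSphere n H x = toSphere n H x' :=
      Subtype.ext_iff.trans hinj.eq_iff
    rw [hFt]
    constructor
    · intro hxx
      classical
      -- The gluing relation lives on the whole plane, so the sphere map is transported to `ℂ`, with
      -- an arbitrary value off the region.
      let g : ℂ → ℂ × ℝ := fun z =>
        if hz : ∃ x : X, (q x : ℂ) = z then toSphere n H hz.choose else 0
      have hg : ∀ x : X, g (q x) = toSphere n H x := fun x => by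
        have hz : ∃ y : X, (q y : ℂ) = q x := ⟨x, rfl⟩
        simp only [g, dif_pos hz]
        exact h.toSphere_eq_of_smul_eq W hz.choose.2 x.2 hz.choose_spec
      have hle : (h.gluing W hd).setoid ≤ Setoid.ker g := by
        refine h.setoid_le W hd fun e he t ht => ?_
        have hmem : ∀ k < n, ∀ t ∈ Set.Icc (0 : ℝ) 1, ((1 : ℝ), (k + t : ℝ)) ∈ X := by
          intro k hk t ht
          have : (k : ℝ) + 1 ≤ n := by exact_mod_cast hk
          exact ⟨by simp, by have := ht.1; positivity, by simp only; linarith [ht.2]⟩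
        have hgk : ∀ k < n, ∀ t ∈ Set.Icc (0 : ℝ) 1,
            g (piecewiseLinear n V (k + t)) = toSphere n H (1, k + t) := by
          intro k hk t ht
          rw [← hg ⟨_, hmem k hk t ht⟩]
          simp [q]
        rw [Setoid.ker_def, hgk e he t ht, hgk (σ e) (h.lt e he) (1 - t)
          ⟨by linarith [ht.2], by linarith [ht.1]⟩, h.toSphere_edge he ht]
      have := hle hxx
      rwa [Setoid.ker_def, hg, hg] at this
    · exact fun e => h.setoid_of_toSphere_eq W hd x.2 x'.2 e
  have hc : Quotient (Setoid.ker (mk ∘ q)) ≃ₜ Quotient (Setoid.ker F) := by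
    rw [hker]
    exact Homeomorph.refl _
  have h1 : Topology.IsQuotientMap (⟨mk ∘ q, hmk.continuous⟩ : C(X, (h.gluing W hd).Surface)) := hmk
  have h2 : Topology.IsQuotientMap
    (⟨F, hF⟩ : C(X, Metric.sphere (0 : EuclideanSpace ℝ (Fin 3)) 1)) := hFq
  exact ⟨(h1.homeomorph.symm.trans hc).trans h2.homeomorph⟩

end Surface

end IsFolding

/-! ### Angles and combinatorial equivalence -/

namespace Polygon

variable {n : ℕ}

lemma angle_nonneg (P : Polygon ℂ n) (i : Fin n) : 0 ≤ P.angle i := by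
  unfold angle
  exact (toIcoMod_mem_Ico _ _ _).1

lemma angle_eq {P : Polygon ℂ n} {i : Fin n} {c A : ℝ} (hc : 0 < c)
    (hA : A ∈ Set.Ico 0 (2 * Real.pi)) (hne : P (finRotate n i) - P i ≠ 0)
    (h : P ((finRotate n).symm i) - P i =
      c * Complex.exp (A * Complex.I) * (P (finRotate n i) - P i)) : P.angle i = A := by
  unfold angle
  rw [h, mul_div_cancel_right₀ _ hne, Complex.arg_real_mul _ hc, Complex.arg_exp_mul_I,
    toIcoMod_eq_iff]
  refine ⟨by simpa using hA, -toIocDiv Real.two_pi_pos (-Real.pi) A, ?_⟩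
  rw [toIocMod, neg_smul, sub_eq_add_neg]

lemma vertex_mem_boundary (P : Polygon ℂ n) (i : Fin n) : P i ∈ P.boundary ℝ := by
  refine Set.mem_iUnion.2 ⟨i, ?_⟩
  exact left_mem_affineSegment ℝ _ _

/-- The label of a node lists the vertices in its fiber, so a label-preserving isomorphism sends the
node of `P i` and `P j` to a node whose fiber contains both. -/
lemma Gluing.CombEquiv.setoid {P : Polygon ℂ n} {G H : Gluing P} (e : G.CombEquiv H)
    {i j : Fin n} (hij : G.setoid (P i) (P j)) : H.setoid (P i) (P j) := by
  obtain ⟨φ, hφ⟩ := e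
  have hi : P i ∈ G.fiber (P i) := ⟨P.vertex_mem_boundary i, Setoid.refl' _ _⟩
  have hj : P j ∈ G.fiber (P i) := ⟨P.vertex_mem_boundary j, hij⟩
  let A : G.Node := ⟨G.fiber (P i), P i, ⟨P.vertex_mem_boundary i, .inr ⟨i, hi⟩⟩, rfl⟩
  have hA := hφ A
  obtain ⟨p, -, hp⟩ := (φ A).2
  have key : ∀ k, P k ∈ G.fiber (P i) → H.setoid p (P k) := fun k hk => by
    have h1 : Sum.inl k ∈ G.label A := hk
    rw [← hA] at h1
    have h2 : P k ∈ (φ A).1 := h1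
    rw [hp] at h2
    exact h2.2
  exact Setoid.trans' _ (Setoid.symm' _ (key i hi)) (key j hj)

lemma Gluing.CombEquiv.symm {P : Polygon ℂ n} {G H : Gluing P} (e : G.CombEquiv H) :
    H.CombEquiv G := by
  obtain ⟨φ, hφ⟩ := e
  refine ⟨φ.symm, fun A => ?_⟩
  rw [← hφ, RelIso.apply_symm_apply]

lemma Gluing.combEquiv_refl {P : Polygon ℂ n} (G : Gluing P) : G.CombEquiv G :=
  ⟨RelIso.refl _, fun _ => rfl⟩

/-- A family of pairwise inequivalent Aleksandrov gluings. -/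
lemma hasDistinctAleksandrovGluings_of_family {P : Polygon ℂ n} {ι : Type*} [Fintype ι]
    (G : ι → Gluing P) (hG : ∀ i, (G i).IsAleksandrov)
    (hne : ∀ i j, (G i).CombEquiv (G j) → i = j) {N : ℝ} (hN : N ≤ Fintype.card ι) :
    P.HasDistinctAleksandrovGluings N := by
  refine ⟨Finset.univ.map ⟨G, fun i j e => hne i j (e ▸ (G i).combEquiv_refl)⟩, ?_, ?_, ?_⟩
  · rw [Finset.card_map, Finset.card_univ]
    exact hN
  · intro A hA
    obtain ⟨i, -, rfl⟩ := Finset.mem_map.1 hA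
    exact hG i
  · intro A hA B hB hAB e
    obtain ⟨i, -, rfl⟩ := Finset.mem_map.1 hA
    obtain ⟨j, -, rfl⟩ := Finset.mem_map.1 hB
    exact hAB (congrArg _ (hne i j e))

end Polygon

namespace WindsOnce

variable {n : ℕ} {V : ℕ → ℂ} {ρ θ : ℕ → ℝ}

lemma edge_eq_edge (W : WindsOnce n V ρ θ) {k k' : ℕ} (hk : k < n) (hk' : k' < n) {t t' : ℝ}
    (ht : t ∈ Set.Ico (0 : ℝ) 1) (ht' : t' ∈ Set.Ico (0 : ℝ) 1)
    (h : piecewiseLinear n V (k + t) = piecewiseLinear n V (k' + t')) : k = k' ∧ t = t' :=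
  (W.eq_of_smul_eq hk hk' ht ht' one_pos one_pos (by rw [h])).2

lemma vertex_injective (W : WindsOnce n V ρ θ) {i j : ℕ} (hi : i < n) (hj : j < n)
    (h : V i = V j) : i = j :=
  (W.edge_eq_edge hi hj (t := 0) (t' := 0) (by simp) (by simp) (by
    rw [add_zero, add_zero, piecewiseLinear_natCast V hi.le, piecewiseLinear_natCast V hj.le, h])).1

lemma faceAngle_vertex (W : WindsOnce n V ρ θ) (i : Fin n) :
    (ofSeq n V).faceAngle (V i) = (ofSeq n V).angle i := by
  have h : ∃ j, ofSeq n V j = V i := ⟨i, rfl⟩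
  rw [faceAngle, dif_pos h]
  congr 1
  exact Fin.ext (W.vertex_injective h.choose.2 i.2 h.choose_spec)

lemma faceAngle_edge (W : WindsOnce n V ρ θ) {k : ℕ} (hk : k < n) {t : ℝ}
    (ht : t ∈ Set.Ioo (0 : ℝ) 1) :
    (ofSeq n V).faceAngle (piecewiseLinear n V (k + t)) = Real.pi := by
  rw [faceAngle, dif_neg]
  rintro ⟨j, hj⟩
  have := (W.edge_eq_edge j.2 hk (t := 0) (by simp) ⟨ht.1.le, ht.2⟩ (by
    rw [add_zero, piecewiseLinear_natCast V j.2.le, ← hj, ofSeq_apply])).2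
  exact ht.1.ne this

lemma faceAngle_nonneg (p : ℂ) : 0 ≤ (ofSeq n V).faceAngle p := by
  rw [faceAngle]
  split_ifs
  · exact angle_nonneg _ _
  · exact Real.pi_pos.le

end WindsOnce

namespace IsFolding

variable {n : ℕ} {σ H : ℕ → ℕ} {V : ℕ → ℂ} {ρ θ : ℕ → ℝ}

/-- A folding is an Aleksandrov gluing if the vertices of each class have total angle at most
`2π`. -/
theorem isAleksandrov (h : IsFolding n σ H) (W : WindsOnce n V ρ θ)
    (hd : ∀ i < n, dist (V (σ i)) (V (σ i + 1)) = dist (V i) (V (i + 1))) {cls : ℕ → ℕ}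
    (hcls : ∀ i < n, cls (σ i + 1) = cls i) (hcls' : cls n = cls 0)
    (hang : ∀ c, ∑ i ∈ Finset.univ.filter (fun i : Fin n => cls i = c), (ofSeq n V).angle i ≤ 2 * Real.pi) :
    (h.gluing W hd).IsAleksandrov := by
  refine ⟨fun p hp s hs => ?_, h.nonempty_surface_homeomorph W hd⟩
  have hvert : ∀ i < n, p = V i → ∑ q ∈ s, (ofSeq n V).faceAngle q ≤ 2 * Real.pi := by
    rintro i hi rfl
    refine le_trans ?_ (hang (cls i))
    have hsub : s ⊆ (Finset.univ.filter fun j : Fin n => cls j = cls i).image fun j : Fin n => V j := by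
      intro q hq
      obtain ⟨j, hj, rfl, hj'⟩ := h.vertex_of_setoid W hd hcls hcls' hi (hs hq).2
      exact Finset.mem_image.2 ⟨⟨j, hj⟩, by simpa using hj', rfl⟩
    refine (Finset.sum_le_sum_of_subset_of_nonneg hsub
      fun q _ _ => WindsOnce.faceAngle_nonneg q).trans ?_
    rw [Finset.sum_image fun i _ j _ e => Fin.ext (W.vertex_injective i.2 j.2 e)]
    exact (Finset.sum_congr rfl fun j _ => W.faceAngle_vertex j).le
  rw [ofSeq_boundary W.n_pos W.closed] at hp
  obtain ⟨u, hu, rfl⟩ := hp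
  obtain ⟨k, hk, t, ht, rfl⟩ := exists_nat_add_of_mem_Icc W.n_pos hu
  rcases ht.1.eq_or_lt with rfl | h0
  · exact hvert k hk (by rw [add_zero, piecewiseLinear_natCast V hk.le])
  rcases ht.2.lt_or_eq with h1 | rfl
  · have hsub : s ⊆ {piecewiseLinear n V (k + t), piecewiseLinear n V (σ k + (1 - t))} := by
      intro q hq
      simpa using h.eq_or_eq_of_setoid W hd hk ⟨h0, h1⟩ (hs hq).2
    have hpi : ∀ q ∈ s, (ofSeq n V).faceAngle q ≤ Real.pi := by
      intro q hq
      rcases h.eq_or_eq_of_setoid W hd hk ⟨h0, h1⟩ (hs hq).2 with rfl | rfl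
      · exact (W.faceAngle_edge hk ⟨h0, h1⟩).le
      · exact (W.faceAngle_edge (h.lt k hk) ⟨by linarith, by linarith⟩).le
    refine (Finset.sum_le_card_nsmul s _ _ hpi).trans ?_
    rw [nsmul_eq_mul]
    have : (s.card : ℝ) ≤ 2 := by exact_mod_cast (Finset.card_le_card hsub).trans Finset.card_le_two
    exact mul_le_mul_of_nonneg_right this Real.pi_pos.le
  · have e5 : piecewiseLinear n V ((k : ℝ) + 1) = V (k + 1) := by
      exact_mod_cast piecewiseLinear_natCast V (show k + 1 ≤ n from hk)
    rcases Nat.lt_or_ge (k + 1) n with h1 | h1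
    · exact hvert (k + 1) h1 e5
    · exact hvert 0 W.n_pos (by rw [e5, show k + 1 = n by omega, W.closed])

/-- The end points of edges that are glued together are glued together. -/
lemma setoid_vertex (h : IsFolding n σ H) (W : WindsOnce n V ρ θ)
    (hd : ∀ i < n, dist (V (σ i)) (V (σ i + 1)) = dist (V i) (V (i + 1))) {e : ℕ} (he : e < n) :
    (h.gluing W hd).setoid (V e) (V (σ e + 1)) := by
  have h1 := h.setoid_of_edge W hd he (t := 0) (by simp)
  rw [add_zero, piecewiseLinear_natCast V he.le, sub_zero] at h1
  have h2 : piecewiseLinear n V ((σ e : ℝ) + 1) = V (σ e + 1) := by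
    exact_mod_cast piecewiseLinear_natCast V (show σ e + 1 ≤ n from h.lt e he)
  rwa [h2] at h1

/-- Foldings that lead to equivalent gluing trees identify the same vertices. -/
lemma cls_eq_of_combEquiv {σ' H' : ℕ → ℕ} (h : IsFolding n σ H) (h' : IsFolding n σ' H')
    (W : WindsOnce n V ρ θ)
    (hd : ∀ i < n, dist (V (σ i)) (V (σ i + 1)) = dist (V i) (V (i + 1)))
    (hd' : ∀ i < n, dist (V (σ' i)) (V (σ' i + 1)) = dist (V i) (V (i + 1))) {cls : ℕ → ℕ}
    (hcls : ∀ i < n, cls (σ i + 1) = cls i) (hcls' : cls n = cls 0)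
    (hcomb : (h'.gluing W hd').CombEquiv (h.gluing W hd)) {e : ℕ} (he : e < n) :
    cls (σ' e + 1) = cls e := by
  have hVj : ∃ j < n, V (σ' e + 1) = V j ∧ cls j = cls (σ' e + 1) := by
    have := h'.lt e he
    rcases Nat.lt_or_ge (σ' e + 1) n with h1 | h1
    · exact ⟨σ' e + 1, h1, rfl, rfl⟩
    · have h2 : σ' e + 1 = n := by omega
      exact ⟨0, W.n_pos, by rw [h2, W.closed], by rw [h2, hcls']⟩
  obtain ⟨j, hj, e1, e2⟩ := hVj
  have h1 := h'.setoid_vertex W hd' he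
  rw [e1] at h1
  have h2 : (h.gluing W hd).setoid (V e) (V j) :=
    hcomb.setoid (i := ⟨e, he⟩) (j := ⟨j, hj⟩) h1
  obtain ⟨k, hk, e3, e4⟩ := h.vertex_of_setoid W hd hcls hcls' he h2
  rw [← e2, W.vertex_injective hj hk e3, e4]

end IsFolding

/-! ### Combinatorics of the star foldings -/

/-- The partner of the edge number `i` of a star polygon with `m` tips and two extra midpoint
vertices. Without any choice, the polygon is folded along the line through the two midpoints. If
`b q` holds, a reflex vertex on either side is folded to a leaf in the `q`-th block of four
edges. -/
def starPartner (m : ℕ) (b : ℕ → Bool) (i : ℕ) : ℕ :=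
  if i ≤ m then
    if b (i / 4) = true then
      if i % 4 = 0 then 2 * m + 1 - i else if i % 4 = 1 then i + 1 else if i % 4 = 2 then i - 1
      else 2 * m + 3 - i
    else 2 * m + 1 - i
  else
    if b ((2 * m + 1 - i) / 4) = true then
      if (2 * m + 1 - i) % 4 = 0 then 2 * m + 1 - i
      else if (2 * m + 1 - i) % 4 = 1 then 2 * m + 3 - i
      else if (2 * m + 1 - i) % 4 = 2 then i - 1 else i + 1
    else 2 * m + 1 - i

/-- The height of the vertex number `k` of the star over the root of the gluing tree. -/
def starHeight (m : ℕ) (b : ℕ → Bool) (k : ℕ) : ℕ :=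
  if k ≤ m + 1 then if b (k / 4) = true ∧ k % 4 = 3 then k - 2 else k
  else if b ((2 * m + 2 - k) / 4) = true ∧ 2 ≤ (2 * m + 2 - k) % 4 then 2 * m + 4 - k
  else 2 * m + 2 - k

/-- The number of the class of vertices of the star that contains the vertex number `k`. -/
def starClass (m : ℕ) (b : ℕ → Bool) (k : ℕ) : ℕ :=
  if k ≤ m + 1 then if b (k / 4) = true ∧ k % 4 = 3 then k - 2 else k
  else if b ((2 * m + 2 - k) / 4) = true ∧ (2 * m + 2 - k) % 4 = 2 then 2 * m + 4 - k
  else 2 * m + 2 - k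

section
variable {m : ℕ} {b : ℕ → Bool} (hb : ∀ q, b q = true → 4 * q + 4 ≤ m)
include hb

lemma starPartner_lt {i : ℕ} (hi : i < 2 * m + 2) : starPartner m b i < 2 * m + 2 := by
  have h1 := hb (i / 4)
  unfold starPartner
  grind

lemma starPartner_starPartner {i : ℕ} (hi : i < 2 * m + 2) :
    starPartner m b (starPartner m b i) = i := by
  have h1 := hb (i / 4)
  have h2 := hb ((2 * m + 1 - i) / 4)
  unfold starPartner
  grind

lemma starPartner_ne {i : ℕ} (hi : i < 2 * m + 2) : starPartner m b i ≠ i := by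
  have h1 := hb (i / 4)
  have h2 := hb ((2 * m + 1 - i) / 4)
  unfold starPartner
  grind

lemma starHeight_lt {i : ℕ} (hi : i < 2 * m + 2) (h : i < starPartner m b i) :
    starHeight m b i < starHeight m b (i + 1) := by
  have h1 := hb (i / 4)
  have h2 := hb ((2 * m + 1 - i) / 4)
  unfold starPartner at h
  unfold starHeight
  grind

lemma starClass_partner {i : ℕ} (hi : i < 2 * m + 2) :
    starClass m b (starPartner m b i + 1) = starClass m b i := by
  have h1 := hb (i / 4)
  have h2 := hb ((2 * m + 1 - i) / 4)
  unfold starPartner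
  unfold starClass
  grind

lemma le_starHeight {i k : ℕ} (hi : i < 2 * m + 2) (hk : i < k) (hk' : k ≤ starPartner m b i) :
    starHeight m b (i + 1) ≤ starHeight m b k := by
  have h1 := hb (i / 4)
  have h2 := hb ((2 * m + 1 - i) / 4)
  unfold starPartner at hk'
  unfold starHeight
  grind

lemma starPartner_isFolding : IsFolding (2 * m + 2) (starPartner m b) (starHeight m b) where
  lt _ hi := starPartner_lt hb hi
  invol _ hi := starPartner_starPartner hb hi
  ne _ hi := starPartner_ne hb hi
  height_lt _ hi h := starHeight_lt hb hi h
  height_partner i hi h := by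
    have h1 := hb (i / 4)
    have h2 := hb ((2 * m + 1 - i) / 4)
    unfold starPartner at h ⊢
    unfold starHeight
    grind
  height_partner_succ i hi h := by
    have h1 := hb (i / 4)
    have h2 := hb ((2 * m + 1 - i) / 4)
    unfold starPartner at h ⊢
    unfold starHeight
    grind
  le_height _ hi _ hk hk' := le_starHeight hb hi hk hk'
  height_zero := by simp [starHeight]
  height_last := by
    unfold starHeight
    grind

omit hb in
lemma starClass_last : starClass m b (2 * m + 2) = starClass m b 0 := by
  unfold starClass
  grind

/-- Only edges with residue `1`, `2` or `3` in a chosen block, or their mirror images, change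
partners. By `hb` no chosen block contains the edge `m`, so half edges still meet half edges. -/
lemma starPartner_half_iff {i : ℕ} (hi : i < 2 * m + 2) :
    (starPartner m b i = 0 ∨ starPartner m b i = m ∨ starPartner m b i = m + 1 ∨
      starPartner m b i = 2 * m + 1) ↔ (i = 0 ∨ i = m ∨ i = m + 1 ∨ i = 2 * m + 1) := by
  have h1 := hb (i / 4)
  have h2 := hb ((2 * m + 1 - i) / 4)
  unfold starPartner
  grind

omit hb in
lemma starClass_eq_zero {k : ℕ} (hk : k < 2 * m + 2) (h : starClass m b k = 0) : k = 0 := by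
  unfold starClass at h
  grind

lemma starClass_eq_middle {k : ℕ} (hk : k < 2 * m + 2) (h : starClass m b k = m + 1) :
    k = m + 1 := by
  have h1 := hb (k / 4)
  have h2 := hb ((2 * m + 2 - k) / 4)
  unfold starClass at h
  grind

/-- The number `k` belongs to a tip of the star. -/
def IsStarTip (m k : ℕ) : Prop := (1 ≤ k ∧ k ≤ m ∧ Odd k) ∨ (m + 2 ≤ k ∧ Odd (k - 1))

/-- Zipping makes both zipped reflex vertices leaves and joins only an extra tip to the classes next
to them, so a class never gains a second reflex vertex. -/
lemma eq_of_starClass_eq {j k : ℕ} (hj : j < 2 * m + 2) (hk : k < 2 * m + 2)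
    (h : starClass m b j = starClass m b k) (hj0 : j ≠ 0) (hj1 : j ≠ m + 1) (hk0 : k ≠ 0)
    (hk1 : k ≠ m + 1) (hjt : ¬ IsStarTip m j) (hkt : ¬ IsStarTip m k) : j = k := by
  unfold IsStarTip at hjt hkt
  rw [Nat.odd_iff, Nat.odd_iff] at hjt hkt
  unfold starClass at h
  grind

omit hb in
-- Mirror vertices have opposite kinds, so exactly one vertex of each mirror pair is a tip; this
-- bounds the number of tips by `m`.
lemma eq_of_min_eq {j k : ℕ} (hj : j < 2 * m + 2) (hk : k < 2 * m + 2)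
    (h : min j (2 * m + 2 - j) = min k (2 * m + 2 - k))
    (hjt : IsStarTip m j) (hkt : IsStarTip m k) : j = k := by
  unfold IsStarTip at hjt hkt
  rw [Nat.odd_iff, Nat.odd_iff] at hjt hkt
  omega

/-- Different choices lead to different classes. -/
lemma eq_of_starClass_partner_eq {b' : ℕ → Bool} {q : ℕ}
    (h : b q = true) (hq : b' q = false) :
    starClass m b (starPartner m b' (4 * q + 2) + 1) ≠ starClass m b (4 * q + 2) := by
  have h1 := hb q h
  have h2 : (4 * q + 2) / 4 = q := by omega
  have h3 : (2 * m + 2 - (2 * m + 1 - (4 * q + 2) + 1)) / 4 = q := by omega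
  unfold starPartner starClass
  grind

end

/-! ### Geometry of the star -/

/-- The central angle between adjacent vertices of a regular star with `m` tips. -/
noncomputable def starStep (m : ℕ) : ℝ := Real.pi / m

/-- Half of the interior angle at the tips of the star. -/
noncomputable def starHalfTip (m : ℕ) : ℝ := Real.pi / m ^ 2

/-- The distance from the center of the vertex number `j` of the regular star. -/
noncomputable def starRadius (m j : ℕ) : ℝ :=
  if Odd j then Real.sin (starHalfTip m + starStep m) else Real.sin (starHalfTip m)

/-- The vertices of the regular star; the tips have the odd numbers. -/
noncomputable def starVertex (m j : ℕ) : ℂ :=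
  starRadius m j * Complex.exp ((starStep m * j : ℝ) * Complex.I)

/-- The direction of the edge of the regular star that follows the vertex number `j`. -/
noncomputable def starDir (m j : ℕ) : ℝ :=
  if Odd j then starStep m * j - starHalfTip m + Real.pi
  else starStep m * (j + 1) + starHalfTip m

section

variable {m : ℕ} (hm : 4 ≤ m)

include hm

lemma starStep_pos : 0 < starStep m := div_pos Real.pi_pos (by positivity)

lemma starHalfTip_pos : 0 < starHalfTip m := div_pos Real.pi_pos (by positivity)

lemma mul_starStep : (m : ℝ) * starStep m = Real.pi := by
  unfold starStep
  field_simp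

lemma mul_starHalfTip : (m : ℝ) * starHalfTip m = starStep m := by
  unfold starStep starHalfTip
  field_simp

lemma starStep_le : starStep m ≤ Real.pi / 4 := by
  have h4 : (4 : ℝ) ≤ m := by exact_mod_cast hm
  unfold starStep
  gcongr

lemma starHalfTip_le : starHalfTip m ≤ Real.pi / 16 := by
  have h4 : (4 : ℝ) ≤ m := by exact_mod_cast hm
  have h1 := mul_starHalfTip hm
  have h2 := starStep_le hm
  have h3 := starHalfTip_pos hm
  nlinarith

lemma sin_starStep_pos : 0 < Real.sin (starStep m) :=
  Real.sin_pos_of_pos_of_lt_pi (starStep_pos hm) (by linarith [starStep_le hm, Real.pi_pos])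

lemma starRadius_pos (j : ℕ) : 0 < starRadius m j := by
  have h1 := starStep_pos hm
  have h2 := starHalfTip_pos hm
  have h3 := starStep_le hm
  have h4 := starHalfTip_le hm
  unfold starRadius
  split_ifs <;> apply Real.sin_pos_of_pos_of_lt_pi <;> linarith [Real.pi_pos]

omit hm in
-- Law of sines in the triangle formed by the center, a reflex vertex and a tip, with angles
-- `starStep m` at the center and `starHalfTip m` at the tip. With circumdiameter one, the edge has
-- length `sin (starStep m)`, and the two radii are those of `starRadius`.
lemma starVertex_succ_sub (j : ℕ) : starVertex m (j + 1) - starVertex m j =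
    Real.sin (starStep m) * Complex.exp (starDir m j * Complex.I) := by
  have key : ∀ a φ δ : ℝ, (Real.sin (δ + φ) : ℂ) * Complex.exp ((a + φ : ℝ) * Complex.I) -
      Real.sin δ * Complex.exp (a * Complex.I) =
      Real.sin φ * Complex.exp ((a + φ + δ : ℝ) * Complex.I) := by
    intro a φ δ
    apply Complex.ext
    · simp only [Complex.sub_re, Complex.re_ofReal_mul, Complex.exp_ofReal_mul_I_re, Real.sin_add,
        Real.cos_add]
      linear_combination (Real.sin δ * Real.cos a) * Real.sin_sq_add_cos_sq φ
    · simp only [Complex.sub_im, Complex.im_ofReal_mul, Complex.exp_ofReal_mul_I_im, Real.sin_add,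
        Real.cos_add]
      linear_combination (Real.sin δ * Real.sin a) * Real.sin_sq_add_cos_sq φ
  unfold starVertex starRadius starDir
  by_cases hj : Odd j
  · have hj' : ¬ Odd (j + 1) := by simpa [Nat.odd_add_one] using hj
    rw [if_neg hj', if_pos hj, if_pos hj]
    -- From a tip to a reflex vertex the same identity is used with both angles negated.
    have h := key (starStep m * (j + 1 : ℕ)) (-starStep m) (-starHalfTip m)
    have e1 : starStep m * (j + 1 : ℕ) + -starStep m = starStep m * j := by
      push_cast
      ring
    have e2 : Complex.exp ((starStep m * j - starHalfTip m + Real.pi : ℝ) * Complex.I) =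
        -Complex.exp ((starStep m * j + -starHalfTip m : ℝ) * Complex.I) := by
      rw [Complex.ofReal_add, add_mul, Complex.exp_add, Complex.exp_pi_mul_I, sub_eq_add_neg]
      ring
    rw [e1, ← neg_add, Real.sin_neg, Real.sin_neg, Real.sin_neg] at h
    rw [e2]
    push_cast at h ⊢
    linear_combination h
  · have hj' : Odd (j + 1) := by simpa [Nat.odd_add_one] using hj
    rw [if_pos hj', if_neg hj, if_neg hj]
    have := key (starStep m * j) (starStep m) (starHalfTip m)
    convert this using 4 <;> push_cast <;> ring

lemma starVertex_add_two_mul (j : ℕ) : starVertex m (j + 2 * m) = starVertex m j := by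
  have h : Odd (j + 2 * m) ↔ Odd j := by simp [Nat.odd_add]
  have e : ((starStep m * (j + 2 * m : ℕ) : ℝ) : ℂ) * Complex.I =
      (starStep m * j : ℝ) * Complex.I + 2 * Real.pi * Complex.I := by
    rw [← mul_starStep hm]
    push_cast
    ring
  rw [starVertex, e, Complex.exp_add, Complex.exp_two_pi_mul_I, mul_one, starVertex, starRadius,
    starRadius]
  simp only [h]

lemma starVertex_add_self (hme : Even m) (j : ℕ) : starVertex m (j + m) = -starVertex m j := by
  have h : Odd (j + m) ↔ Odd j := by simp [Nat.odd_add, hme]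
  have e : ((starStep m * (j + m : ℕ) : ℝ) : ℂ) * Complex.I =
      (starStep m * j : ℝ) * Complex.I + Real.pi * Complex.I := by
    rw [← mul_starStep hm]
    push_cast
    ring
  rw [starVertex, e, Complex.exp_add, Complex.exp_pi_mul_I, starVertex, starRadius, starRadius]
  simp only [h]
  ring

/-- The direction of the midpoint is strictly between those of the end points, so inserting it as a
vertex keeps the polar angles strictly increasing. -/
lemma exists_polar_midpoint (j : ℕ) : ∃ ψ ∈ Set.Ioo 0 (starStep m), ∃ R : ℝ, 0 < R ∧
    midpoint ℝ (starVertex m j) (starVertex m (j + 1)) =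
      R * Complex.exp ((starStep m * j + ψ : ℝ) * Complex.I) := by
  have hp1 := starRadius_pos hm j
  have hp2 := starRadius_pos hm (j + 1)
  have hφ := starStep_pos hm
  have hφ' : starStep m < Real.pi := by linarith [starStep_le hm, Real.pi_pos]
  obtain ⟨R, hR, ψ, hψ, e⟩ := exists_polar_of_sector (half_pos hp1) (half_pos hp2).le hφ hφ'
  have hψ0 : ψ ≠ 0 := by
    rintro rfl
    have := congrArg Complex.im e
    simp only [Complex.add_im, Complex.ofReal_im, Complex.im_ofReal_mul,
      Complex.exp_ofReal_mul_I_im, Real.sin_zero, mul_zero, zero_add] at this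
    exact (mul_pos (half_pos hp2) (sin_starStep_pos hm)).ne' this
  refine ⟨ψ, ⟨lt_of_le_of_ne hψ.1 hψ0.symm, hψ.2⟩, R, hR, ?_⟩
  have e1 : Complex.exp ((starStep m * j + ψ : ℝ) * Complex.I) =
      Complex.exp ((starStep m * j : ℝ) * Complex.I) * Complex.exp (ψ * Complex.I) := by
    rw [← Complex.exp_add]
    congr 1
    push_cast
    ring
  have e2 : Complex.exp ((starStep m * (j + 1 : ℕ) : ℝ) * Complex.I) =
      Complex.exp ((starStep m * j : ℝ) * Complex.I) * Complex.exp (starStep m * Complex.I) := by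
    rw [← Complex.exp_add]
    congr 1
    push_cast
    ring
  rw [e1, mul_left_comm, ← e, midpoint_eq_smul_add, starVertex, starVertex, e2, Complex.real_smul,
    invOf_eq_inv]
  push_cast
  ring

end

/-- The vertices of the star with two additional midpoint vertices. -/
noncomputable def midStarVertex (m k : ℕ) : ℂ :=
  if k = 0 ∨ k = 2 * m + 2 then midpoint ℝ (starVertex m 0) (starVertex m 1)
  else if k = m + 1 then midpoint ℝ (starVertex m m) (starVertex m (m + 1))
  else if k ≤ m then starVertex m k else starVertex m (k - 1)

section

variable {m : ℕ} (hm : 4 ≤ m)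

lemma midStarVertex_zero : midStarVertex m 0 = midpoint ℝ (starVertex m 0) (starVertex m 1) := by
  simp [midStarVertex]

lemma midStarVertex_last : midStarVertex m (2 * m + 2) = midStarVertex m 0 := by
  simp [midStarVertex]

lemma midStarVertex_middle :
    midStarVertex m (m + 1) = midpoint ℝ (starVertex m m) (starVertex m (m + 1)) := by
  have : ¬ (m + 1 = 0 ∨ m + 1 = 2 * m + 2) := by omega
  rw [midStarVertex, if_neg this, if_pos rfl]

lemma midStarVertex_of_le {k : ℕ} (h0 : 1 ≤ k) (h1 : k ≤ m) :
    midStarVertex m k = starVertex m k := by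
  rw [midStarVertex, if_neg (by omega), if_neg (by omega), if_pos h1]

lemma midStarVertex_of_ge {k : ℕ} (h0 : m + 2 ≤ k) (h1 : k ≤ 2 * m + 1) :
    midStarVertex m k = starVertex m (k - 1) := by
  rw [midStarVertex, if_neg (by omega), if_neg (by omega), if_neg (by omega)]

include hm

lemma exists_windsOnce_midStarVertex :
    ∃ ρ θ : ℕ → ℝ, WindsOnce (2 * m + 2) (midStarVertex m) ρ θ := by
  obtain ⟨ψ, hψ, R, hR, e⟩ := exists_polar_midpoint hm 0
  obtain ⟨ψ', hψ', R', hR', e'⟩ := exists_polar_midpoint hm m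
  have hφ := starStep_pos hm
  have hφ' := starStep_le hm
  have hpi := Real.pi_pos
  have hmφ := mul_starStep hm
  let θ : ℕ → ℝ := fun k => if k = 0 then ψ else if k = 2 * m + 2 then 2 * Real.pi + ψ
    else if k = m + 1 then starStep m * m + ψ' else
    if k ≤ m then starStep m * k else starStep m * (k - 1 : ℕ)
  have t0 : θ 0 = ψ := if_pos rfl
  have t1 : θ (2 * m + 2) = 2 * Real.pi + ψ := by
    simp only [θ, if_neg (show ¬ (2 * m + 2 = 0) by omega), if_true]
  have t2 : θ (m + 1) = starStep m * m + ψ' := by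
    simp only [θ, if_neg (show ¬ (m + 1 = 0) by omega),
      if_neg (show ¬ (m + 1 = 2 * m + 2) by omega), if_true]
  have t3 : ∀ k, 1 ≤ k → k ≤ m → θ k = starStep m * k := fun k h1 h2 => by
    simp only [θ, if_neg (show ¬ (k = 0) by omega), if_neg (show ¬ (k = 2 * m + 2) by omega),
      if_neg (show ¬ (k = m + 1) by omega), if_pos h2]
  have t4 : ∀ k, m + 2 ≤ k → k ≤ 2 * m + 1 → θ k = starStep m * (k - 1 : ℕ) := fun k h1 h2 => by
    simp only [θ, if_neg (show ¬ (k = 0) by omega), if_neg (show ¬ (k = 2 * m + 2) by omega),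
      if_neg (show ¬ (k = m + 1) by omega), if_neg (show ¬ (k ≤ m) by omega)]
  have hθ : ∀ k < 2 * m + 2, θ k < θ (k + 1) ∧ θ (k + 1) - θ k ≤ starStep m := by
    intro k hk
    rcases Nat.eq_zero_or_pos k with rfl | h0
    · rw [t0, t3 _ (by omega) (by omega)]
      push_cast
      constructor <;> linarith [hψ.1, hψ.2]
    rcases Nat.lt_trichotomy k m with h1 | rfl | h1
    · rw [t3 k h0 h1.le, t3 (k + 1) (by omega) h1]
      push_cast
      constructor <;> linarith
    · rw [t3 k h0 le_rfl, t2]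
      constructor <;> linarith [hψ'.1, hψ'.2]
    rcases (show m + 1 ≤ k from h1).eq_or_lt with rfl | h2
    · rw [t2, t4 (m + 1 + 1) (by omega) (by omega), Nat.add_sub_cancel]
      push_cast
      constructor <;> linarith [hψ'.1, hψ'.2]
    rcases Nat.lt_or_ge k (2 * m + 1) with h3 | h3
    · rw [t4 k h2 h3.le, t4 (k + 1) (by omega) (by omega), Nat.add_sub_cancel,
        Nat.cast_sub h0]
      push_cast
      constructor <;> linarith
    · have : k = 2 * m + 1 := by omega
      subst this
      rw [t4 _ h2 le_rfl, t1, Nat.add_sub_cancel]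
      push_cast
      constructor <;> linarith [hψ.1, hψ.2]
  refine ⟨fun k => if k = 0 ∨ k = 2 * m + 2 then R else if k = m + 1 then R' else
    if k ≤ m then starRadius m k else starRadius m (k - 1),
    θ, ?_, ?_, fun k hk => (hθ k hk).1, fun k hk => by linarith [(hθ k hk).2],
    midStarVertex_last, by rw [t0, t1]; ring⟩
  · intro k
    split_ifs
    exacts [hR, hR', starRadius_pos hm _, starRadius_pos hm _]
  · intro k
    unfold midStarVertex
    simp only [θ]
    by_cases h0 : k = 0
    · simpa [h0] using e
    by_cases h1 : k = 2 * m + 2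
    · simp only [h1, or_true, if_true, if_neg (show ¬ (2 * m + 2 = 0) by omega)]
      have e1 : (((2 * Real.pi + ψ : ℝ) : ℂ) * Complex.I) =
          ψ * Complex.I + 2 * Real.pi * Complex.I := by
        push_cast
        ring
      rw [e1, Complex.exp_add, Complex.exp_two_pi_mul_I, mul_one]
      simpa using e
    simp only [h0, h1, or_self, if_false]
    split_ifs
    · exact e'
    · rfl
    · rfl

end

/-- The interior angle of the regular star at the vertex number `j`. -/
noncomputable def starAngle (m j : ℕ) : ℝ :=
  if Odd j then 2 * starHalfTip m else 2 * Real.pi - 2 * starStep m - 2 * starHalfTip m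

/-- The interior angle is `π` minus the turn of the edge direction. -/
lemma starDir_sub (m j : ℕ) :
    starDir m j - starDir m (j + 1) + Real.pi = starAngle m (j + 1) := by
  unfold starDir starAngle
  by_cases hj : Odd j
  · have hj' : ¬ Odd (j + 1) := by simpa [Nat.odd_add_one] using hj
    rw [if_pos hj, if_neg hj', if_neg hj']
    push_cast
    ring
  · have hj' : Odd (j + 1) := by simpa [Nat.odd_add_one] using hj
    rw [if_neg hj, if_pos hj', if_pos hj']
    push_cast
    ring

/-- The edges number `k` of the star that are halves of edges of the regular star. -/
def IsHalfEdge (m k : ℕ) : Prop := k = 0 ∨ k = m ∨ k = m + 1 ∨ k = 2 * m + 1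

open Classical in
/-- The lengths of the edges of the star with midpoints. -/
noncomputable def midStarLength (m k : ℕ) : ℝ :=
  if IsHalfEdge m k then Real.sin (starStep m) / 2 else Real.sin (starStep m)

section

variable {m : ℕ} (hm : 4 ≤ m)

include hm

lemma starAngle_mem (j : ℕ) : starAngle m j ∈ Set.Ico 0 (2 * Real.pi) := by
  have h1 := starStep_pos hm
  have h2 := starHalfTip_pos hm
  have h3 := starStep_le hm
  have h4 := starHalfTip_le hm
  have := Real.pi_pos
  unfold starAngle
  split_ifs <;> constructor <;> linarith

lemma midStarLength_pos (k : ℕ) : 0 < midStarLength m k := by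
  have := sin_starStep_pos hm
  unfold midStarLength
  split_ifs <;> positivity

lemma midStarVertex_succ_sub {k : ℕ} (hk : k < 2 * m + 2) :
    midStarVertex m (k + 1) - midStarVertex m k = midStarLength m k *
      Complex.exp (starDir m (if k ≤ m then k else k - 1) * Complex.I) := by
  have hl : ∀ a b : ℂ, midpoint ℝ a b - a = (b - a) / 2 := fun a b => by
    rw [midpoint_sub_left, invOf_eq_inv, Complex.real_smul]
    push_cast
    ring
  have hr : ∀ a b : ℂ, b - midpoint ℝ a b = (b - a) / 2 := fun a b => by
    rw [right_sub_midpoint, invOf_eq_inv, Complex.real_smul]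
    push_cast
    ring
  have hh : IsHalfEdge m k → ((midStarLength m k : ℝ) : ℂ) = Real.sin (starStep m) / 2 :=
    fun h => by
      rw [midStarLength, if_pos h]
      push_cast
      rfl
  have hn : ¬ IsHalfEdge m k → midStarLength m k = Real.sin (starStep m) := fun h => by
    rw [midStarLength, if_neg h]
  rcases Nat.eq_zero_or_pos k with rfl | h0
  · rw [midStarVertex_zero, midStarVertex_of_le le_rfl (by omega), hr, starVertex_succ_sub,
      hh (.inl rfl), if_pos (Nat.zero_le _)]
    ring
  rcases Nat.lt_trichotomy k m with h1 | rfl | h1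
  · rw [midStarVertex_of_le h0 h1.le, midStarVertex_of_le (by omega) h1, starVertex_succ_sub,
      hn (by unfold IsHalfEdge; omega), if_pos h1.le]
  · rw [midStarVertex_of_le h0 le_rfl, midStarVertex_middle, hl, starVertex_succ_sub,
      hh (.inr (.inl rfl)), if_pos le_rfl]
    ring
  rcases (show m + 1 ≤ k from h1).eq_or_lt with rfl | h2
  · rw [midStarVertex_middle, midStarVertex_of_ge (by omega) (by omega), Nat.add_sub_cancel, hr,
      starVertex_succ_sub, hh (.inr (.inr (.inl rfl))), if_neg (by omega), Nat.add_sub_cancel]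
    ring
  rcases Nat.lt_or_ge k (2 * m + 1) with h3 | h3
  · have h4 := starVertex_succ_sub (m := m) (k - 1)
    rw [Nat.sub_add_cancel h0] at h4
    rw [midStarVertex_of_ge h2 h3.le, midStarVertex_of_ge (by omega) (by omega),
      Nat.add_sub_cancel, h4, hn (by unfold IsHalfEdge; omega), if_neg (by omega)]
  · have : k = 2 * m + 1 := by omega
    subst this
    have h4 := starVertex_succ_sub (m := m) (2 * m)
    have h5 := starVertex_add_two_mul hm 0
    have h6 := starVertex_add_two_mul hm 1
    rw [zero_add] at h5
    rw [add_comm] at h6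
    rw [midStarVertex_of_ge h2 le_rfl, midStarVertex_last, midStarVertex_zero,
      Nat.add_sub_cancel, ← h5, ← h6, hl, h4, hh (.inr (.inr (.inr rfl))), if_neg (by omega)]
    ring

lemma dist_midStarVertex {k : ℕ} (hk : k < 2 * m + 2) :
    dist (midStarVertex m k) (midStarVertex m (k + 1)) = midStarLength m k := by
  rw [dist_comm, dist_eq_norm, midStarVertex_succ_sub hm hk, norm_mul,
    Complex.norm_exp_ofReal_mul_I, mul_one, Complex.norm_real, Real.norm_eq_abs,
    abs_of_pos (midStarLength_pos hm k)]

/-- Vertex angles are read off from the edge directions up to full turns, which `z` counts; the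
lengths of the two edges cancel from the argument. Only the vertex `0` needs a nonzero `z`, because
the directions gain a full turn around the polygon. -/
lemma angle_midStar_eq {i : Fin (2 * m + 2)} {p : ℕ} (hp : p < 2 * m + 2)
    (hpi : midStarVertex m (p + 1) = midStarVertex m i)
    (hpi' : p = if (i : ℕ) = 0 then 2 * m + 2 - 1 else i - 1) {A : ℝ}
    (hA : A ∈ Set.Ico 0 (2 * Real.pi)) (z : ℤ)
    (h : starDir m (if p ≤ m then p else p - 1) -
      starDir m (if (i : ℕ) ≤ m then (i : ℕ) else i - 1) + Real.pi = A + z * (2 * Real.pi)) :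
    (ofSeq (2 * m + 2) (midStarVertex m)).angle i = A := by
  have hnext := midStarVertex_succ_sub hm i.2
  have hprev := midStarVertex_succ_sub hm hp
  have hl := midStarLength_pos hm i
  have hlp := midStarLength_pos hm p
  refine angle_eq (c := midStarLength m p / midStarLength m i) (by positivity) hA ?_ ?_
  · rw [ofSeq_finRotate midStarVertex_last, ofSeq_apply, hnext]
    exact mul_ne_zero (Complex.ofReal_ne_zero.2 hl.ne') (Complex.exp_ne_zero _)
  · rw [ofSeq_finRotate midStarVertex_last, ofSeq_finRotate_symm midStarVertex_last, ← hpi',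
      ofSeq_apply, hnext, ← hpi, ← neg_sub, hprev]
    set η := starDir m (if p ≤ m then p else p - 1)
    set η' := starDir m (if (i : ℕ) ≤ m then (i : ℕ) else i - 1)
    have e1 : Complex.exp (A * Complex.I) * Complex.exp (η' * Complex.I) =
        -Complex.exp (η * Complex.I) := by
      rw [← Complex.exp_add, neg_eq_neg_one_mul, ← Complex.exp_pi_mul_I, ← Complex.exp_add,
        Complex.exp_eq_exp_iff_exists_int]
      refine ⟨-z, ?_⟩
      have h' : ((η - η' + Real.pi : ℝ) : ℂ) = (A + z * (2 * Real.pi) : ℝ) := by rw [h]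
      push_cast at h' ⊢
      linear_combination (-Complex.I) * h'
    have hl' : ((midStarLength m i : ℝ) : ℂ) ≠ 0 := Complex.ofReal_ne_zero.2 hl.ne'
    generalize Complex.exp (A * Complex.I) = a at e1 ⊢
    generalize Complex.exp (η' * Complex.I) = a' at e1 ⊢
    push_cast
    field_simp
    linear_combination (-(midStarLength m p : ℂ)) * e1

lemma angle_midStar_of_le {i : Fin (2 * m + 2)} (h0 : 1 ≤ (i : ℕ)) (h1 : (i : ℕ) ≤ m) :
    (ofSeq (2 * m + 2) (midStarVertex m)).angle i = starAngle m i := by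
  have h2 : (i : ℕ) - 1 + 1 = i := Nat.sub_add_cancel h0
  refine angle_midStar_eq hm (p := i - 1) (by omega) (by rw [h2]) (by rw [if_neg (by omega)])
    (starAngle_mem hm _) 0 ?_
  have := starDir_sub m (i - 1)
  rw [h2] at this
  rw [if_pos (by omega), if_pos h1, this]
  simp

lemma angle_midStar_of_ge {i : Fin (2 * m + 2)} (h0 : m + 2 ≤ (i : ℕ)) :
    (ofSeq (2 * m + 2) (midStarVertex m)).angle i = starAngle m (i - 1) := by
  refine angle_midStar_eq hm (p := i - 1) (by omega) (by rw [Nat.sub_add_cancel (by omega)])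
    (by rw [if_neg (by omega)]) (starAngle_mem hm _) 0 ?_
  have := starDir_sub m (i - 1 - 1)
  rw [Nat.sub_add_cancel (by omega)] at this
  rw [if_neg (by omega), if_neg (by omega), this]
  simp

lemma angle_midStar_zero {i : Fin (2 * m + 2)} (h0 : (i : ℕ) = 0) :
    (ofSeq (2 * m + 2) (midStarVertex m)).angle i = Real.pi := by
  have hpi := Real.pi_pos
  refine angle_midStar_eq hm (p := 2 * m + 1) (by omega) (by rw [midStarVertex_last, h0])
    (by rw [if_pos h0]; rfl) ⟨hpi.le, by linarith⟩ 1 ?_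
  have h1 : ¬ Odd (2 * m) := by simp
  rw [if_neg (by omega), if_pos (by omega), h0, Nat.add_sub_cancel, starDir, starDir, if_neg h1,
    if_neg (by simp)]
  have := mul_starStep hm
  push_cast
  linear_combination 2 * this

lemma angle_midStar_middle {i : Fin (2 * m + 2)} (h0 : (i : ℕ) = m + 1) :
    (ofSeq (2 * m + 2) (midStarVertex m)).angle i = Real.pi := by
  have hpi := Real.pi_pos
  refine angle_midStar_eq hm (p := m) (by omega) (by rw [h0])
    (by rw [if_neg (by omega), h0, Nat.add_sub_cancel]) ⟨hpi.le, by linarith⟩ 0 ?_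
  rw [if_pos le_rfl, if_neg (by omega), h0, Nat.add_sub_cancel]
  simp

/-- The tip angle is chosen for this: `m * starHalfTip m` equals `starStep m`, so the sum is `2π`
minus one tip angle. -/
lemma mul_starAngle_add_lt :
    m * (2 * starHalfTip m) + (2 * Real.pi - 2 * starStep m - 2 * starHalfTip m) <
      2 * Real.pi := by
  have h1 := mul_starHalfTip hm
  have h2 := starHalfTip_pos hm
  linarith

lemma isStarWithMidpoints (hme : Even m) :
    (ofSeq (2 * m + 2) (midStarVertex m)).IsStarWithMidpoints := by
  have hv : ∀ k, (ofSeq (2 * m + 2) (midStarVertex m)).vertexAt k =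
      midStarVertex m (k % (2 * m + 2)) := fun k => rfl
  have hv' : ∀ k < 2 * m + 2, (ofSeq (2 * m + 2) (midStarVertex m)).vertexAt k =
      midStarVertex m k := fun k hk => by rw [hv, Nat.mod_eq_of_lt hk]
  -- Central symmetry needs `m` even: the half turn shifts star indices by `m`, and this must
  -- preserve the parity that separates tips from reflex vertices.
  have hsym : ∀ k < m + 1, midStarVertex m (k + (m + 1)) = -midStarVertex m k := by
    intro k hk
    rcases Nat.eq_zero_or_pos k with rfl | h0
    · have h1 := starVertex_add_self hm hme 0
      have h2 := starVertex_add_self hm hme 1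
      rw [zero_add] at h1
      rw [add_comm] at h2
      rw [zero_add, midStarVertex_middle, midStarVertex_zero, h1, h2, midpoint_eq_smul_add,
        midpoint_eq_smul_add, ← neg_add, smul_neg]
    · rw [midStarVertex_of_ge (by omega) (by omega), midStarVertex_of_le h0 (by omega),
        ← starVertex_add_self hm hme]
      rfl
  have hfull : ∀ k < 2 * m + 2, ¬ IsHalfEdge m k →
      dist (midStarVertex m k) (midStarVertex m (k + 1)) = Real.sin (starStep m) :=
    fun k hk h => by rw [dist_midStarVertex hm hk, midStarLength, if_neg h]
  have hstar : ∀ j, dist (starVertex m j) (starVertex m (j + 1)) = Real.sin (starStep m) := by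
    intro j
    rw [dist_comm, dist_eq_norm, starVertex_succ_sub, norm_mul, Complex.norm_exp_ofReal_mul_I,
      mul_one, Complex.norm_real, Real.norm_eq_abs, abs_of_pos (sin_starStep_pos hm)]
  have h2m : midStarVertex m (2 * m + 1) = starVertex m 0 := by
    have h5 := starVertex_add_two_mul hm 0
    rw [zero_add] at h5
    rw [midStarVertex_of_ge (by omega) le_rfl, Nat.add_sub_cancel, h5]
  have h1 : midStarVertex m 1 = starVertex m 1 := midStarVertex_of_le le_rfl (by omega)
  have hm1 : midStarVertex m m = starVertex m m := midStarVertex_of_le (by omega) le_rfl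
  have hm2 : midStarVertex m (m + 2) = starVertex m (m + 1) :=
    midStarVertex_of_ge le_rfl (by omega)
  refine ⟨⟨0, fun k => ?_⟩, ?_, ?_, ⟨Real.sin (starStep m), ?_, ?_, fun k hk hk' => ⟨?_, ?_⟩⟩,
    2 * starHalfTip m, 2 * Real.pi - 2 * starStep m - 2 * starHalfTip m, ?_, ?_, ?_,
    mul_starAngle_add_lt hm, fun k hk hk' => ⟨?_, ?_⟩⟩
  · rw [hv, hv, Equiv.pointReflection_apply, vsub_eq_sub, zero_sub, vadd_eq_add, add_zero]
    have hlt := Nat.mod_lt k (show 0 < 2 * m + 2 by omega)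
    rcases Nat.lt_or_ge (k % (2 * m + 2)) (m + 1) with h | h
    · rw [← hsym _ h, Nat.add_mod, Nat.mod_eq_of_lt (show m + 1 < 2 * m + 2 by omega),
        Nat.mod_eq_of_lt (by omega)]
    · have h2 := hsym (k % (2 * m + 2) - (m + 1)) (by omega)
      rw [Nat.sub_add_cancel h] at h2
      rw [h2, neg_neg, Nat.add_mod, Nat.mod_eq_of_lt (show m + 1 < 2 * m + 2 by omega),
        Nat.mod_eq_sub_mod (by omega), Nat.mod_eq_of_lt (by omega)]
      congr 1
      omega
  · rw [hv' 0 (by omega), hv' _ (by omega), hv' 1 (by omega), h2m, h1, midStarVertex_zero]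
  · rw [hv' _ (by omega), hv' _ (by omega), hv' _ (by omega), hm1, hm2, midStarVertex_middle]
  · rw [hv' _ (by omega), hv' _ (by omega), h2m, h1, hstar]
  · rw [hv' _ (by omega), hv' _ (by omega), hm1, hm2, hstar]
  · rw [hv' _ (by omega), hv' _ (by omega)]
    exact hfull k (by omega) (by unfold IsHalfEdge; omega)
  · rw [hv' _ (by omega), hv' _ (by omega)]
    exact hfull (m + 1 + k) (by omega) (by unfold IsHalfEdge; omega)
  · linarith [starHalfTip_pos hm]
  · linarith [starHalfTip_le hm, Real.pi_pos]
  · linarith [starHalfTip_le hm, starStep_le hm, Real.pi_pos]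
  · have h : ((Fin.ofNat (2 * m + 2) k : Fin (2 * m + 2)) : ℕ) = k :=
      Nat.mod_eq_of_lt (by omega)
    rw [angle_midStar_of_le hm (by omega) (by omega), h, starAngle]
  · have h : ((Fin.ofNat (2 * m + 2) (m + 1 + k) : Fin (2 * m + 2)) : ℕ) = m + 1 + k :=
      Nat.mod_eq_of_lt (by omega)
    have h2 : m + 1 + k - 1 = k + m := by omega
    rw [angle_midStar_of_ge hm (by omega), h, h2, starAngle]
    simp only [Nat.odd_add, hme, iff_true]

end

/-! ### The distinct gluings of the star -/

section

variable {m : ℕ} (hm : 4 ≤ m) {b : ℕ → Bool}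

include hm

lemma dist_starPartner (hb : ∀ q, b q = true → 4 * q + 4 ≤ m) (i : ℕ) (hi : i < 2 * m + 2) :
    dist (midStarVertex m (starPartner m b i)) (midStarVertex m (starPartner m b i + 1)) =
      dist (midStarVertex m i) (midStarVertex m (i + 1)) := by
  have h : IsHalfEdge m (starPartner m b i) ↔ IsHalfEdge m i := starPartner_half_iff hb hi
  rw [dist_midStarVertex hm hi, dist_midStarVertex hm (starPartner_lt hb hi)]
  unfold midStarLength
  by_cases h2 : IsHalfEdge m i
  · rw [if_pos h2, if_pos (h.2 h2)]
  · rw [if_neg h2, if_neg fun h3 => h2 (h.1 h3)]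

lemma angle_midStar_of_tip {i : Fin (2 * m + 2)} (h : IsStarTip m i) :
    (ofSeq (2 * m + 2) (midStarVertex m)).angle i = 2 * starHalfTip m := by
  rcases h with ⟨h0, h1, h2⟩ | ⟨h0, h2⟩
  · rw [angle_midStar_of_le hm h0 h1, starAngle, if_pos h2]
  · rw [angle_midStar_of_ge hm h0, starAngle, if_pos h2]

lemma angle_midStar_of_not_tip {i : Fin (2 * m + 2)} (h0 : (i : ℕ) ≠ 0) (h1 : (i : ℕ) ≠ m + 1)
    (h : ¬ IsStarTip m i) : (ofSeq (2 * m + 2) (midStarVertex m)).angle i =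
      2 * Real.pi - 2 * starStep m - 2 * starHalfTip m := by
  unfold IsStarTip at h
  rcases Nat.lt_or_ge m i with h2 | h2
  · rw [angle_midStar_of_ge hm (by omega), starAngle, if_neg fun h3 => h (.inr ⟨by omega, h3⟩)]
  · rw [angle_midStar_of_le hm (by omega) h2, starAngle,
      if_neg fun h3 => h (.inl ⟨by omega, h2, h3⟩)]

/-- The two midpoints are alone in their classes and have angle `π`. Any other class has at most `m`
tips and one reflex vertex; the crude count `m` is enough for the star's angle condition. -/
lemma sum_angle_midStar_le (hb : ∀ q, b q = true → 4 * q + 4 ≤ m) (c : ℕ) :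
    ∑ i ∈ Finset.univ.filter (fun i : Fin (2 * m + 2) => starClass m b i = c),
      (ofSeq (2 * m + 2) (midStarVertex m)).angle i ≤ 2 * Real.pi := by
  classical
  have hpi := Real.pi_pos
  have hone : ∀ j : Fin (2 * m + 2), (∀ i : Fin (2 * m + 2), starClass m b i = c → i = j) →
      (ofSeq (2 * m + 2) (midStarVertex m)).angle j = Real.pi →
      ∑ i ∈ Finset.univ.filter (fun i : Fin (2 * m + 2) => starClass m b i = c),
        (ofSeq (2 * m + 2) (midStarVertex m)).angle i ≤ 2 * Real.pi := by
    intro j hj hang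
    have hsub : Finset.univ.filter (fun i : Fin (2 * m + 2) => starClass m b i = c) ⊆ {j} :=
      fun i hi => Finset.mem_singleton.2 (hj i (Finset.mem_filter.1 hi).2)
    refine (Finset.sum_le_sum_of_subset_of_nonneg hsub
      fun i _ _ => angle_nonneg _ _).trans ?_
    rw [Finset.sum_singleton, hang]
    linarith
  by_cases h0 : c = 0
  · exact hone ⟨0, by omega⟩ (fun i hi => Fin.ext (starClass_eq_zero i.2 (hi.trans h0)))
      (angle_midStar_zero hm rfl)
  by_cases h1 : c = m + 1
  · exact hone ⟨m + 1, by omega⟩ (fun i hi => Fin.ext (starClass_eq_middle hb i.2 (hi.trans h1)))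
      (angle_midStar_middle hm rfl)
  have hne0 : ∀ i : Fin (2 * m + 2), starClass m b i = c → (i : ℕ) ≠ 0 := by
    intro i hi h
    refine h0 ?_
    rw [← hi, h]
    simp [starClass]
  have hne1 : ∀ i : Fin (2 * m + 2), starClass m b i = c → (i : ℕ) ≠ m + 1 := by
    intro i hi h
    refine h1 ?_
    have := hb ((m + 1) / 4)
    rw [← hi, h]
    unfold starClass
    grind
  rw [← Finset.sum_filter_add_sum_filter_not _ (fun i : Fin (2 * m + 2) => IsStarTip m i)]
  have hδ := starHalfTip_pos hm
  have htip : ∑ i ∈ (Finset.univ.filter (fun i : Fin (2 * m + 2) => starClass m b i = c)).filter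
      (fun i : Fin (2 * m + 2) => IsStarTip m i),
      (ofSeq (2 * m + 2) (midStarVertex m)).angle i ≤ m * (2 * starHalfTip m) := by
    refine (Finset.sum_le_card_nsmul _ _ (2 * starHalfTip m) fun i hi =>
      (angle_midStar_of_tip hm (Finset.mem_filter.1 hi).2).le).trans ?_
    rw [nsmul_eq_mul]
    refine mul_le_mul_of_nonneg_right ?_ (by positivity)
    have hcard := Finset.card_le_card_of_injOn
      (s := (Finset.univ.filter (fun i : Fin (2 * m + 2) => starClass m b i = c)).filter
        (fun i : Fin (2 * m + 2) => IsStarTip m i)) (t := Finset.Icc 1 m)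
      (fun i : Fin (2 * m + 2) => min (i : ℕ) (2 * m + 2 - i)) (fun i hi => ?_)
      (fun i hi j hj hij => ?_)
    · rw [Nat.card_Icc, Nat.add_sub_cancel] at hcard
      exact_mod_cast hcard
    · have h := (Finset.mem_filter.1 hi).2
      unfold IsStarTip at h
      have := i.2
      simp only [Finset.coe_Icc, Set.mem_Icc]
      omega
    · exact Fin.ext (eq_of_min_eq i.2 j.2 hij (Finset.mem_filter.1 hi).2
        (Finset.mem_filter.1 hj).2)
  have hnot : ∑ i ∈ (Finset.univ.filter (fun i : Fin (2 * m + 2) => starClass m b i = c)).filter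
      (fun i : Fin (2 * m + 2) => ¬ IsStarTip m i),
      (ofSeq (2 * m + 2) (midStarVertex m)).angle i ≤
        2 * Real.pi - 2 * starStep m - 2 * starHalfTip m := by
    refine (Finset.sum_le_card_nsmul _ _ (2 * Real.pi - 2 * starStep m - 2 * starHalfTip m)
      fun i hi => ?_).trans ?_
    · simp only [Finset.mem_filter, Finset.mem_univ, true_and] at hi
      exact (angle_midStar_of_not_tip hm (hne0 i hi.1) (hne1 i hi.1) hi.2).le
    · rw [nsmul_eq_mul]
      refine mul_le_of_le_one_left ?_ ?_
      · linarith [starStep_le hm, starHalfTip_le hm]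
      · norm_cast
        refine Finset.card_le_one.2 fun i hi j hj => ?_
        simp only [Finset.mem_filter, Finset.mem_univ, true_and] at hi hj
        exact Fin.ext (eq_of_starClass_eq hb i.2 j.2 (hi.1.trans hj.1.symm) (hne0 i hi.1)
          (hne1 i hi.1) (hne0 j hj.1) (hne1 j hj.1) hi.2 hj.2)
  linarith [mul_starAngle_add_lt hm]

/-- The star with `m` tips and two midpoint vertices has `2 ^ (m / 4)` distinct gluings. -/
theorem hasDistinctAleksandrovGluings_midStar {N : ℝ} (hN : N ≤ 2 ^ (m / 4)) :
    (ofSeq (2 * m + 2) (midStarVertex m)).HasDistinctAleksandrovGluings N := by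
  obtain ⟨ρ, θ, W⟩ := exists_windsOnce_midStarVertex hm
  -- Blocks beyond the complete ones are never zipped, which gives the condition `hb` of the
  -- combinatorial lemmas.
  let ext : (Fin (m / 4) → Bool) → ℕ → Bool := fun b q => if h : q < m / 4 then b ⟨q, h⟩ else false
  have hext : ∀ b q, ext b q = true → 4 * q + 4 ≤ m := by
    intro b q h
    by_cases hq : q < m / 4
    · omega
    · simp [ext, hq] at h
  have hcls : ∀ b, ∀ i < 2 * m + 2,
      starClass m (ext b) (starPartner m (ext b) i + 1) = starClass m (ext b) i :=
    fun b i hi => starClass_partner (hext b) hi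
  refine hasDistinctAleksandrovGluings_of_family
    (fun b => (starPartner_isFolding (hext b)).gluing W (dist_starPartner hm (hext b)))
    (fun b => (starPartner_isFolding (hext b)).isAleksandrov W _ (hcls b) starClass_last
      (sum_angle_midStar_le hm (hext b))) (fun b b' e => ?_) (by simpa using hN)
  have key : ∀ b b', ((starPartner_isFolding (hext b')).gluing W
      (dist_starPartner hm (hext b'))).CombEquiv ((starPartner_isFolding (hext b)).gluing W
      (dist_starPartner hm (hext b))) → ∀ q, b q = true → b' q = true := by
    intro b b' e q hq
    by_contra hq'
    rw [Bool.not_eq_true] at hq'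
    have h1 : ext b q = true := by simpa [ext] using hq
    have h2 : ext b' q = false := by simpa [ext] using hq'
    have h3 := hext b q h1
    exact eq_of_starClass_partner_eq (hext b) h1 h2
      ((starPartner_isFolding (hext b)).cls_eq_of_combEquiv (starPartner_isFolding (hext b')) W _ _
        (hcls b) starClass_last e (by omega))
  funext q
  exact Bool.eq_iff_iff.2 ⟨key b b' e.symm q, key b' b e q⟩

end

/-! ### Small cases and the conclusion -/

/-- The vertices of the regular polygon with `n` vertices. -/
noncomputable def regularVertex (n k : ℕ) : ℂ :=
  Complex.exp ((2 * Real.pi / n * k : ℝ) * Complex.I)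

/-- The foldings of the regular polygon along the diagonals through the vertices number `0` (for
`false`) and number `1` (for `true`). -/
def regularPartner (n : ℕ) (b : Bool) (i : ℕ) : ℕ :=
  if b = true then if i ≤ 1 then 1 - i else n + 1 - i else n - 1 - i

/-- The height of the vertex number `k` of the regular polygon over the root of the gluing tree. -/
def regularHeight (n : ℕ) (b : Bool) (k : ℕ) : ℕ :=
  if b = true then if k ≤ 1 then k else min (k - 2) (n - k) else min k (n - k)

/-- The number of the class of vertices that contains the vertex number `k`. -/
def regularClass (n : ℕ) (b : Bool) (k : ℕ) : ℕ :=
  if b = true then if k = 0 then 0 else if k = 1 then n else min (k - 2) (n - k)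
  else min k (n - k)

section

variable {n : ℕ} (hn : 4 ≤ n)

include hn

lemma windsOnce_regularVertex :
    WindsOnce n (regularVertex n) (fun _ => 1) fun k => 2 * Real.pi / n * k where
  pos _ := one_pos
  eq k := by simp [regularVertex]
  lt k _ := by
    have : 0 < 2 * Real.pi / n := div_pos Real.two_pi_pos (by positivity)
    push_cast
    linarith
  sub_lt k _ := by
    have h4 : (4 : ℝ) ≤ n := by exact_mod_cast hn
    have : 2 * Real.pi / n < Real.pi := by
      rw [div_lt_iff₀ (by positivity)]
      nlinarith [Real.pi_pos]
    push_cast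
    linarith
  closed := by
    have : 2 * Real.pi / n * n = 2 * Real.pi := by field_simp
    simp only [regularVertex, this]
    simp
  winding := by
    field_simp
    simp

omit hn in
lemma regularPartner_isFolding (he : Even n) (b : Bool) :
    IsFolding n (regularPartner n b) (regularHeight n b) := by
  obtain ⟨k, rfl⟩ := he
  constructor <;> grind [regularPartner, regularHeight]

omit hn in
lemma regularVertex_mul (i j : ℕ) :
    regularVertex n (i + j) = regularVertex n i * regularVertex n j := by
  unfold regularVertex
  rw [← Complex.exp_add]
  congr 1
  push_cast
  ring

omit hn in
lemma dist_regularVertex (k : ℕ) : dist (regularVertex n k) (regularVertex n (k + 1)) =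
    ‖1 - regularVertex n 1‖ := by
  rw [dist_eq_norm, regularVertex_mul, ← mul_one_sub, norm_mul, regularVertex,
    Complex.norm_exp_ofReal_mul_I, one_mul]

lemma angle_regular_le (i : Fin n) : (ofSeq n (regularVertex n)).angle i ≤ Real.pi := by
  have W := windsOnce_regularVertex hn
  have hstep : 0 < 2 * Real.pi / n := div_pos Real.two_pi_pos (by positivity)
  have hsub : 2 * Real.pi / n < Real.pi := by simpa [mul_add] using W.sub_lt 0 (by omega)
  refine le_trans (angle_eq (c := 1) (A := Real.pi - 2 * Real.pi / n) one_pos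
    ⟨by linarith, by linarith [Real.pi_pos]⟩ ?_ ?_).le (by linarith)
  · rw [← (finRotate n).symm_apply_apply i, ofSeq_finRotate W.closed,
      (finRotate n).symm_apply_apply, ofSeq_apply, sub_ne_zero]
    intro h
    have h1 := dist_regularVertex (n := n) i
    have h2 := dist_regularVertex (n := n) 0
    rw [h, dist_self, eq_comm, norm_eq_zero, sub_eq_zero] at h1
    have := W.vertex_injective (i := 0) (j := 1) (by omega) (by omega)
      (by rw [← h1]; simp [regularVertex])
    omega
  · rw [ofSeq_finRotate W.closed, ofSeq_finRotate_symm W.closed, ofSeq_apply]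
    set p := if (i : ℕ) = 0 then n - 1 else i - 1 with hp
    have hpi : regularVertex n i = regularVertex n p * regularVertex n 1 := by
      rw [← regularVertex_mul]
      by_cases h0 : (i : ℕ) = 0
      · rw [hp, if_pos h0, h0, Nat.sub_add_cancel (by omega), W.closed]
      · rw [hp, if_neg h0, Nat.sub_add_cancel (by omega)]
    have e : Complex.exp ((Real.pi - 2 * Real.pi / n : ℝ) * Complex.I) * regularVertex n 1 =
        -1 := by
      rw [regularVertex, ← Complex.exp_add, ← Complex.exp_pi_mul_I]
      congr 1
      push_cast
      ring
    rw [regularVertex_mul, hpi]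
    push_cast at e ⊢
    linear_combination (-(regularVertex n p) * (regularVertex n 1 - 1)) * e

/-- The regular polygon with an even number of vertices has two distinct Aleksandrov gluings. -/
theorem hasDistinctAleksandrovGluings_regular (he : Even n) {N : ℝ} (hN : N ≤ 2) :
    (ofSeq n (regularVertex n)).HasDistinctAleksandrovGluings N := by
  have W := windsOnce_regularVertex hn
  have hF := regularPartner_isFolding he
  have hd : ∀ b, ∀ i < n, dist (regularVertex n (regularPartner n b i))
      (regularVertex n (regularPartner n b i + 1)) =
      dist (regularVertex n i) (regularVertex n (i + 1)) := fun b i _ => by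
    rw [dist_regularVertex, dist_regularVertex]
  have hcls : ∀ b, ∀ i < n, regularClass n b (regularPartner n b i + 1) = regularClass n b i := by
    intro b i hi
    unfold regularClass regularPartner
    grind
  have hcls' : ∀ b, regularClass n b n = regularClass n b 0 := by
    intro b
    unfold regularClass
    grind
  refine hasDistinctAleksandrovGluings_of_family (fun b : Bool => (hF b).gluing W (hd b))
    (fun b => (hF b).isAleksandrov W (hd b) (hcls b) (hcls' b) fun c => ?_) (fun b b' e => ?_)
    (by simpa using hN)
  -- Each class has at most two vertices, and each angle is at most `π`.
  · refine (Finset.sum_le_card_nsmul _ _ Real.pi fun i _ => angle_regular_le hn i).trans ?_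
    rw [nsmul_eq_mul]
    refine mul_le_mul_of_nonneg_right ?_ Real.pi_pos.le
    norm_cast
    by_contra! hcard
    obtain ⟨i, hi, j, hj, k, hk, hij, hik, hjk⟩ := Finset.two_lt_card.1 hcard
    simp only [Finset.mem_filter, Finset.mem_univ, true_and] at hi hj hk
    rw [ne_eq, Fin.ext_iff] at hij hik hjk
    have := i.2
    have := j.2
    have := k.2
    unfold regularClass at hi hj hk
    cases b <;> grind
  -- Folding about the vertex `1` glues the vertices `0` and `2`; folding about the vertex `0`
  -- leaves the vertex `0` alone in its class, which differs from that of `2` because `4 ≤ n`.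
  · have key : ¬ ((hF true).gluing W (hd true)).CombEquiv ((hF false).gluing W (hd false)) := by
      intro e
      have := (hF false).cls_eq_of_combEquiv (hF true) W (hd false) (hd true) (hcls false)
        (hcls' false) e (e := 0) (by omega)
      unfold regularClass regularPartner at this
      grind
    cases b <;> cases b'
    · rfl
    · exact absurd e.symm key
    · exact absurd e key
    · rfl

end

/-- The inequality `m + 1 ≤ 8 * (m / 4)` is tight at `m = 7`, where the rounded quotient is `1`;
this fixes the constant `1 / 16`. -/
lemma two_rpow_le_two_pow_div {m : ℕ} (hm : 4 ≤ m) :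
    (2 : ℝ) ^ (1 / 16 * ((2 * m + 2 : ℕ) : ℝ)) ≤ 2 ^ (m / 4) := by
  rw [← Real.rpow_natCast]
  refine Real.rpow_le_rpow_of_exponent_le one_le_two ?_
  have h : m + 1 ≤ 8 * (m / 4) := by omega
  have h' : (m : ℝ) + 1 ≤ 8 * (m / 4 : ℕ) := by exact_mod_cast h
  push_cast at h' ⊢
  linarith

theorem mainTheorem1 :
    ∃ c : ℝ, 0 < c ∧
      (∀ n : ℕ, Even n → 4 ≤ n →
        ∃ P : Polygon ℂ n, P.IsSimple ∧ P.IsCounterclockwise ∧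
          P.HasDistinctAleksandrovGluings ((2 : ℝ) ^ (c * (n : ℝ)))) ∧
      (∀ m : ℕ, Even m → 4 ≤ m →
        ∃ P : Polygon ℂ (2 * m + 2), P.IsSimple ∧ P.IsCounterclockwise ∧
          P.IsStarWithMidpoints ∧
          P.HasDistinctAleksandrovGluings ((2 : ℝ) ^ (c * ((2 * m + 2 : ℕ) : ℝ)))) := by
  refine ⟨1 / 16, by norm_num, fun n he hn => ?_, fun m he hm => ?_⟩
  -- The star construction needs `m ≥ 4`, that is `n ≥ 10`, but no parity of `m`. Below that `n / 16
  -- < 1`, so two gluings are enough.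
  · rcases Nat.lt_or_ge n 10 with h | h
    · have W := windsOnce_regularVertex hn
      refine ⟨ofSeq n (regularVertex n), W.isSimple, W.isCounterclockwise,
        hasDistinctAleksandrovGluings_regular hn he ?_⟩
      have h' : (n : ℝ) ≤ 10 := by exact_mod_cast h.le
      calc (2 : ℝ) ^ (1 / 16 * (n : ℝ)) ≤ 2 ^ (1 : ℝ) :=
            Real.rpow_le_rpow_of_exponent_le one_le_two (by linarith)
        _ = 2 := Real.rpow_one 2
    · obtain ⟨k, rfl⟩ := he
      obtain ⟨m, rfl⟩ : ∃ m, k = m + 1 := ⟨k - 1, by omega⟩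
      have hm : 4 ≤ m := by omega
      rw [show m + 1 + (m + 1) = 2 * m + 2 by ring]
      obtain ⟨ρ, θ, W⟩ := exists_windsOnce_midStarVertex hm
      exact ⟨ofSeq _ (midStarVertex m), W.isSimple, W.isCounterclockwise,
        hasDistinctAleksandrovGluings_midStar hm (two_rpow_le_two_pow_div hm)⟩
  · obtain ⟨ρ, θ, W⟩ := exists_windsOnce_midStarVertex hm
    exact ⟨ofSeq _ (midStarVertex m), W.isSimple, W.isCounterclockwise,
      isStarWithMidpoints hm he,
      hasDistinctAleksandrovGluings_midStar hm (two_rpow_le_two_pow_div hm)⟩
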